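/- Let $K>0$. For $n\ge 1$ let $X=(x_{ij})_{i,j=1}^n$ be a random matrix with independent complex-valued (possibly real-valued) entries, not necessarily identically distributed and not necessarily symmetric in law, such that for all $i,j$ $$\mathbb{E}[x_{ij}]=0,\qquad \mathbb{E}[|x_{ij}|^2]=1,\qquad \mathbb{E}[|x_{ij}|^m]\le (Km)^m\quad\text{for every integer } m\ge 1 .$$ Let $b_{ij}\ge 0$ be the scalars with homogeneous variance profile $b_{ij}^2=\frac1n$ for all $i,j$, and set $A=(b_{ij}x_{ij})_{i,j=1}^n$, so that $A=n^{-1/2}X$. Write $A^*$ for the conjugate transpose of $A$. Then $\operatorname{Tr}(A^p(A^*)^p)$ is integrable in the cases below, and the following hold. (1) For every sequence of such matrices $X=X_n$, one for each $n$, with the same constant $K$, and every sequence of integers $p=p_n\ge 0$ with $p_n/\sqrt n\to 0$ as $n\to\infty$, $$\mathbb{E}\left[\operatorname{Tr}(A^{p}(A^*)^{p})\right]=n(1+o(1))\qquad (n\to\infty).$$ (2) There are constants $C_0,C_1>0$ depending only on $K$ such that, for all $n\ge 1$, all such $X$ and all integers $p\ge 0$ with $p^2\le C_0 n$, $$\mathbb{E}\left[\operatorname{Tr}(A^p(A^*)^p)\right]\le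 C_1 n .$$ -/

import Mathlib

open MeasureTheory ProbabilityTheory Filter Topology Asymptotics Matrix
open scoped ComplexOrder

universe u

/-- The square random matrix `X = (x_ij)` of size `n` has independent complex-valued (in particular,
possibly real-valued) entries that are centered, have unit variance, and satisfy the sub-exponential
moment bound `E |x_ij|^m ≤ (K m)^m` for every integer `m ≥ 1`. The entries need not be identically
distributed, nor symmetric. -/
structure IsSubexpMatrix {Ω : Type u} [MeasurableSpace Ω] (P : Measure Ω) (K : ℝ) {n : ℕ}
    (X : Ω → Matrix (Fin n) (Fin n) ℂ) : Prop where
  measurable_entry : ∀ i j, Measurable fun ω => X ω i j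
  indep : iIndepFun (fun (e : Fin n × Fin n) (ω : Ω) => X ω e.1 e.2) P
  mean_zero : ∀ i j, ∫ ω, X ω i j ∂P = 0
  variance_one : ∀ i j, ∫ ω, ‖X ω i j‖ ^ 2 ∂P = 1
  integrable_moment : ∀ i j, ∀ m : ℕ, 1 ≤ m → Integrable (fun ω => ‖X ω i j‖ ^ m) P
  moment_le : ∀ i j, ∀ m : ℕ, 1 ≤ m → ∫ ω, ‖X ω i j‖ ^ m ∂P ≤ (K * m) ^ m

/-- The matrix `A = (b_ij x_ij)` obtained from `X = (x_ij)` and the scalars `b_ij`. -/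
def weightedMatrix {n : ℕ} (b : Matrix (Fin n) (Fin n) ℝ) (X : Matrix (Fin n) (Fin n) ℂ) :
    Matrix (Fin n) (Fin n) ℂ :=
  Matrix.of fun i j => (b i j : ℂ) * X i j

/-- The scalars `b_ij` are non-negative and the variance profile `(b_ij ^ 2)` is the homogeneous
one, all of whose entries are `1 / n`. -/
def IsHomogeneousProfile {n : ℕ} (b : Matrix (Fin n) (Fin n) ℝ) : Prop :=
  (∀ i j, 0 ≤ b i j) ∧ ∀ i j, b i j ^ 2 = 1 / (n : ℝ)

/-- `Tr (A ^ p (A^*) ^ p)`, where `A^*` is the conjugate transpose. -/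
def traceMoment {n : ℕ} (p : ℕ) (A : Matrix (Fin n) (Fin n) ℂ) : ℂ :=
  (A ^ p * Aᴴ ^ p).trace

/-! The trace expands over pairs of walks `u`, `v` of length `p` with common ends, and each pair
contributes a mixed moment of the entries, normalized by `n ^ (-p)`. By independence and centering,
a pair in which some edge is traversed exactly once in total contributes zero. A pair `u = v` with
`u` self-avoiding contributes exactly 1, and there are n(n-1)...(n-p) = n^(p+1) + O(p² n^p) of them.
The remaining tangled pairs contribute O(p² n^p) in absolute value when p² ≤ C₀ n. Hence the
expected trace is n + O(p²), which is `exists_norm_integral_traceMoment_sub_le`; both claims follow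
from it.

The tangled pairs are grouped by their joint edge multiplicities `M`, called a flow. Walking with
transition probabilities M_ij / (outflow of i) shows that at most ∏ outflow^outflow / ∏ M^M pairs
share a given flow and start (`card_pairs_mul_le`). Call the source, the sink and the vertices of
total degree at least 3 heavy. Every other vertex in use has one incoming and one outgoing edge, of
equal multiplicity, so a flow is a graph of `k` paths of constant multiplicity joining `r` heavy
vertices. The outflow factor of a light vertex cancels against M^M on its only outgoing edge, so
that combinatorial factors survive only at heavy vertices and at the first edges of the paths
(`prod_weight`).

Let e = k + 1 - r. After normalization each path costs a factor 1/n, while the heavy labels give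
n^r. A path of multiplicity m ≥ 3 is geometrically suppressed in its length, because (Km)^m ≤
n^((m-2)/2) / 2 for m ≤ 2p; the sum over m is geometric with ratio O(p/√n). Only paths of
multiplicity 2 have free lengths. If there are E of them, the total length leaves E - 1 degrees of
freedom, and counting degrees with a parity argument gives E - 1 ≤ 2e. This yields p^(2e), and the
powers of k produced by tails, labels and lengths balance, so the flows with given `r` and `k` weigh
at most n^(p+1) (p²/n)^e C^k (`PairFlow.sum_weight_le_pow`). Heavy degrees also give k ≤ 3e + 1, and
tangledness gives e ≥ 1, so the sum over `e` and `k` is a geometric series of size O(p²/n). -/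

/-! ### Multiplicity flows on a finite digraph -/

section Flow

set_option linter.unusedSectionVars false

variable {V : Type*} [Fintype V] [DecidableEq V]

/-- The out-neighbours of `c` in the support of the multiplicity function `M`. -/
def outNbr (M : V → V → ℕ) (c : V) : Finset V := {j | M c j ≠ 0}

/-- The in-neighbours of `c` in the support of the multiplicity function `M`. -/
def inNbr (M : V → V → ℕ) (c : V) : Finset V := {j | M j c ≠ 0}

/-- The total multiplicity of the edges leaving `c`. -/
def outFlow (M : V → V → ℕ) (c : V) : ℕ := ∑ j, M c j

/-- The properties of the edge multiplicities of a pair of walks of length `p` from `s` to `z` in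
which no edge is traversed exactly once in total. -/
structure IsPairFlow (p : ℕ) (M : V → V → ℕ) (s z : V) : Prop where
  ne_one : ∀ i j, M i j ≠ 1
  balance : ∀ c, (∑ j, M c j) + (if c = z then 2 else 0) = (∑ j, M j c) + (if c = s then 2 else 0)
  total : ∑ i, ∑ j, M i j = 2 * p
  pos : 0 < p
  walk : ∀ i j, M i j ≠ 0 → ∃ (T : ℕ) (x : ℕ → V) (t : ℕ), t < T ∧ x 0 = s ∧ x T = z ∧
    (∀ τ < T, M (x τ) (x (τ + 1)) ≠ 0) ∧ x t = i ∧ x (t + 1) = j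

/-- The branching vertices of a flow, together with its source and its sink. -/
def heavyVerts (M : V → V → ℕ) (s z : V) : Finset V :=
  {c | c = s ∨ c = z ∨ 3 ≤ (outNbr M c).card + (inNbr M c).card}

/-- The edges of positive multiplicity. -/
def flowEdges (M : V → V → ℕ) : Finset (V × V) := {e | M e.1 e.2 ≠ 0}

/-- The edges of positive multiplicity that leave a heavy vertex. -/
def rootEdges (M : V → V → ℕ) (s z : V) : Finset (V × V) :=
  {e | M e.1 e.2 ≠ 0 ∧ e.1 ∈ heavyVerts M s z}

open Classical in
/-- Some out-neighbour of `c`, if there is one. -/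
noncomputable def nextVert (M : V → V → ℕ) (c : V) : V :=
  if h : ∃ j, M c j ≠ 0 then h.choose else c

/-- The vertices of the path that starts with the edge `e`. -/
noncomputable def pathVert (M : V → V → ℕ) (e : V × V) : ℕ → V
  | 0 => e.1
  | i + 1 => (nextVert M)^[i] e.2

/-- The number of interior vertices of the path from the edge `e` to the next heavy vertex. -/
noncomputable def pathLen (M : V → V → ℕ) (s z : V) (e : V × V) : ℕ :=
  sInf {i | (nextVert M)^[i] e.2 ∈ heavyVerts M s z}

/-- The edge number `i` of the path that starts with the edge `e`. -/
noncomputable def pathEdge (M : V → V → ℕ) (e : V × V) (i : ℕ) : V × V :=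
  (pathVert M e i, pathVert M e (i + 1))

variable {M : V → V → ℕ} {s z : V} {p : ℕ}

@[simp] lemma pathEdge_zero (e : V × V) : pathEdge M e 0 = e := rfl

@[simp] lemma mem_flowEdges {e : V × V} : e ∈ flowEdges M ↔ M e.1 e.2 ≠ 0 := by simp [flowEdges]

@[simp] lemma mem_rootEdges {e : V × V} :
    e ∈ rootEdges M s z ↔ M e.1 e.2 ≠ 0 ∧ e.1 ∈ heavyVerts M s z := by simp [rootEdges]

lemma nextVert_spec {c j : V} (h : M c j ≠ 0) : M c (nextVert M c) ≠ 0 := by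
  have h' : ∃ j, M c j ≠ 0 := ⟨j, h⟩
  unfold nextVert
  rw [dif_pos h']
  exact h'.choose_spec

lemma sum_out_eq_zero_iff {c : V} : ∑ j, M c j = 0 ↔ outNbr M c = ∅ := by
  simp [outNbr, Finset.filter_eq_empty_iff]

lemma sum_in_eq_zero_iff {c : V} : ∑ j, M j c = 0 ↔ inNbr M c = ∅ := by
  simp [inNbr, Finset.filter_eq_empty_iff]

namespace IsPairFlow

variable (hM : IsPairFlow p M s z)
include hM

lemma balance_of_ne {c : V} (hs : c ≠ s) (hz : c ≠ z) : ∑ j, M c j = ∑ j, M j c := by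
  simpa [hs, hz] using hM.balance c

lemma nbr_pos_iff {c : V} (hs : c ≠ s) (hz : c ≠ z) :
    0 < (outNbr M c).card ↔ 0 < (inNbr M c).card := by
  rw [Finset.card_pos, Finset.card_pos, Finset.nonempty_iff_ne_empty,
    Finset.nonempty_iff_ne_empty, not_iff_not, ← sum_out_eq_zero_iff, ← sum_in_eq_zero_iff,
    hM.balance_of_ne hs hz]

lemma light_ne {c : V} (hc : c ∉ heavyVerts M s z) : c ≠ s ∧ c ≠ z := by
  simp only [heavyVerts, Finset.mem_filter, Finset.mem_univ, true_and, not_or] at hc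
  exact ⟨hc.1, hc.2.1⟩

lemma light_card {c : V} (hc : c ∉ heavyVerts M s z)
    (h : 0 < (outNbr M c).card ∨ 0 < (inNbr M c).card) :
    (outNbr M c).card = 1 ∧ (inNbr M c).card = 1 := by
  obtain ⟨hs, hz⟩ := hM.light_ne hc
  have := hM.nbr_pos_iff hs hz
  simp only [heavyVerts, Finset.mem_filter, Finset.mem_univ, true_and, not_or] at hc
  omega

lemma light_in_unique {c a b : V} (hc : c ∉ heavyVerts M s z) (ha : M a c ≠ 0) (hb : M b c ≠ 0) :
    a = b := by
  have ha' : a ∈ inNbr M c := by simpa [inNbr] using ha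
  have hb' : b ∈ inNbr M c := by simpa [inNbr] using hb
  have h := (hM.light_card hc (Or.inr (Finset.card_pos.2 ⟨a, ha'⟩))).2
  exact Finset.card_le_one.1 h.le _ ha' _ hb'

lemma light_out_unique {c a b : V} (hc : c ∉ heavyVerts M s z) (ha : M c a ≠ 0) (hb : M c b ≠ 0) :
    a = b := by
  have ha' : a ∈ outNbr M c := by simpa [outNbr] using ha
  have hb' : b ∈ outNbr M c := by simpa [outNbr] using hb
  have h := (hM.light_card hc (Or.inl (Finset.card_pos.2 ⟨a, ha'⟩))).1
  exact Finset.card_le_one.1 h.le _ ha' _ hb'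

lemma light_outFlow {c a : V} (hc : c ∉ heavyVerts M s z) (ha : M c a ≠ 0) :
    outFlow M c = M c a := by
  refine Finset.sum_eq_single a (fun b _ hb => ?_) (by simp)
  by_contra h
  exact hb (hM.light_out_unique hc h ha)

lemma light_inFlow {c a : V} (hc : c ∉ heavyVerts M s z) (ha : M a c ≠ 0) :
    ∑ j, M j c = M a c := by
  refine Finset.sum_eq_single a (fun b _ hb => ?_) (by simp)
  by_contra h
  exact hb (hM.light_in_unique hc h ha)

lemma light_out_of_in {c a : V} (hc : c ∉ heavyVerts M s z) (ha : M a c ≠ 0) :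
    M c (nextVert M c) = M a c := by
  obtain ⟨hs, hz⟩ := hM.light_ne hc
  have ha' : a ∈ inNbr M c := by simpa [inNbr] using ha
  have h := (hM.nbr_pos_iff hs hz).2 (Finset.card_pos.2 ⟨a, ha'⟩)
  obtain ⟨j, hj⟩ := Finset.card_pos.1 h
  have hj' : M c j ≠ 0 := by simpa [outNbr] using hj
  rw [← hM.light_outFlow hc (nextVert_spec hj'), ← hM.light_inFlow hc ha, outFlow,
    hM.balance_of_ne hs hz]

lemma light_in_of_out {c a : V} (hc : c ∉ heavyVerts M s z) (ha : M c a ≠ 0) :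
    ∃ b, M b c = M c a ∧ M b c ≠ 0 := by
  obtain ⟨hs, hz⟩ := hM.light_ne hc
  have ha' : a ∈ outNbr M c := by simpa [outNbr] using ha
  have h := (hM.nbr_pos_iff hs hz).1 (Finset.card_pos.2 ⟨a, ha'⟩)
  obtain ⟨j, hj⟩ := Finset.card_pos.1 h
  have hj' : M j c ≠ 0 := by simpa [inNbr] using hj
  refine ⟨j, ?_, hj'⟩
  rw [← hM.light_outFlow hc ha, ← hM.light_inFlow hc hj', outFlow, hM.balance_of_ne hs hz]

/-! ### Decomposition of a flow into paths between heavy vertices -/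

omit hM in
lemma source_mem : s ∈ heavyVerts M s z := by simp [heavyVerts]

omit hM in
lemma sink_mem : z ∈ heavyVerts M s z := by simp [heavyVerts]

/-- The edge lies on a walk in the support that ends at the sink. As long as only light vertices are
met, the continuation of this walk is forced and agrees with the iterates of `nextVert`; the sink is
heavy. This makes the infimum in `pathLen` attained. -/
lemma exists_iterate_mem {e : V × V} (he : M e.1 e.2 ≠ 0) :
    ∃ i, (nextVert M)^[i] e.2 ∈ heavyVerts M s z := by
  by_contra! hcon
  obtain ⟨T, x, t, htT, -, hxT, hstep, h1, h2⟩ := hM.walk _ _ he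
  have key : ∀ i, t + 1 + i ≤ T → x (t + 1 + i) = (nextVert M)^[i] e.2 := by
    intro i
    induction i with
    | zero => intro _; simpa using h2
    | succ i ih =>
      intro hi
      have hx := ih (by omega)
      have hs := hstep (t + 1 + i) (by omega)
      rw [Function.iterate_succ_apply', ← hx]
      exact hM.light_out_unique (by rw [hx]; exact hcon i) hs (nextVert_spec hs)
  have := key (T - (t + 1)) (by omega)
  rw [show t + 1 + (T - (t + 1)) = T by omega, hxT] at this
  have hz := hcon (T - (t + 1))
  rw [← this] at hz
  exact hz sink_mem

lemma pathLen_mem {e : V × V} (he : M e.1 e.2 ≠ 0) :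
    pathVert M e (pathLen M s z e + 1) ∈ heavyVerts M s z :=
  Nat.sInf_mem (s := {i | (nextVert M)^[i] e.2 ∈ heavyVerts M s z}) (hM.exists_iterate_mem he)

omit hM in
lemma pathVert_light {e : V × V} {i : ℕ} (hi : i < pathLen M s z e) :
    pathVert M e (i + 1) ∉ heavyVerts M s z :=
  Nat.notMem_of_lt_sInf hi

lemma pathEdge_mult {e : V × V} (he : M e.1 e.2 ≠ 0) {i : ℕ} (hi : i ≤ pathLen M s z e) :
    M (pathEdge M e i).1 (pathEdge M e i).2 = M e.1 e.2 := by
  induction i with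
  | zero => rfl
  | succ i ih =>
    have h := ih (by omega)
    have hl := pathVert_light (M := M) (s := s) (z := z) (e := e) (i := i) (by omega)
    rw [← h]
    simp only [pathEdge] at h ⊢
    have h' : pathVert M e (i + 1 + 1) = nextVert M (pathVert M e (i + 1)) := by
      simp only [pathVert, Function.iterate_succ_apply']
    rw [h']
    exact hM.light_out_of_in hl (by rw [h]; exact he)

/-- A light vertex has a unique incoming edge, so a path can be traced backwards until its first
edge, the only one whose tail is heavy. -/
lemma pathEdge_injective {e e' : V × V} (he : e ∈ rootEdges M s z) (he' : e' ∈ rootEdges M s z)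
    {i i' : ℕ} (hi : i ≤ pathLen M s z e) (hi' : i' ≤ pathLen M s z e')
    (h : pathEdge M e i = pathEdge M e' i') : e = e' ∧ i = i' := by
  rw [mem_rootEdges] at he he'
  induction i generalizing i' with
  | zero =>
    cases i' with
    | zero => exact ⟨by simpa using h, rfl⟩
    | succ i' =>
      have := pathVert_light (M := M) (s := s) (z := z) (e := e') (i := i') (by omega)
      have h1 : e.1 = pathVert M e' (i' + 1) := congrArg Prod.fst h
      exact absurd (h1 ▸ he.2) this
  | succ i ih =>
    have hl := pathVert_light (M := M) (s := s) (z := z) (e := e) (i := i) (by omega)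
    have h1 : pathVert M e (i + 1) = pathVert M e' i' := congrArg Prod.fst h
    cases i' with
    | zero => exact absurd (by rw [h1]; exact he'.2) hl
    | succ i' =>
      have m1 := hM.pathEdge_mult he.1 (i := i) (by omega)
      have m2 := hM.pathEdge_mult he'.1 (i := i') (by omega)
      have h3 : pathVert M e i = pathVert M e' i' := by
        refine hM.light_in_unique hl (a := pathVert M e i) (b := pathVert M e' i') ?_ ?_
        · exact m1 ▸ he.1
        · rw [h1]; exact m2 ▸ he'.1
      have := ih (i' := i') (by omega) (by omega) (by simp [pathEdge, h1, h3])
      exact ⟨this.1, by omega⟩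

/-- Follow a walk from the source to the edge: at a heavy vertex a new path begins, at a light
vertex the current one is continued. With `pathEdge_injective` this partitions the edges into paths.
-/
lemma exists_pathEdge {i j : V} (h : M i j ≠ 0) :
    ∃ e ∈ rootEdges M s z, ∃ t ≤ pathLen M s z e, pathEdge M e t = (i, j) := by
  obtain ⟨T, x, t, htT, hx0, -, hstep, rfl, rfl⟩ := hM.walk _ _ h
  clear h
  induction t with
  | zero =>
    exact ⟨(x 0, x 1), mem_rootEdges.2 ⟨hstep 0 htT, hx0 ▸ source_mem⟩, 0, by simp, rfl⟩
  | succ t ih =>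
    obtain ⟨e, he, a, ha, hea⟩ := ih (by omega)
    have he' := (mem_rootEdges.1 he).1
    by_cases hx : x (t + 1) ∈ heavyVerts M s z
    · exact ⟨(x (t + 1), x (t + 1 + 1)), by simp [hstep _ htT, hx], 0, by simp, rfl⟩
    · have hxe : pathVert M e (a + 1) = x (t + 1) := congrArg Prod.snd hea
      have hal : a ≠ pathLen M s z e := by
        rintro rfl
        exact hx (hxe ▸ hM.pathLen_mem he')
      refine ⟨e, he, a + 1, by omega, ?_⟩
      have hm := hM.pathEdge_mult he' (i := a + 1) (by omega)
      have : pathVert M e (a + 1 + 1) = x (t + 1 + 1) := by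
        refine hM.light_out_unique hx ?_ (hstep _ htT)
        rw [← hxe]
        simp only [pathEdge] at hm
        rw [hm]
        exact he'
      simp [pathEdge, hxe, this]

lemma prod_flowEdges {α : Type*} [CommMonoid α] (φ : V × V → α) :
    ∏ e ∈ flowEdges M, φ e =
      ∏ b ∈ rootEdges M s z, ∏ t ∈ Finset.range (pathLen M s z b + 1), φ (pathEdge M b t) := by
  rw [Finset.prod_sigma']
  symm
  refine Finset.prod_bij (fun x _ => pathEdge M x.1 x.2) ?_ ?_ ?_ ?_
  · rintro ⟨b, t⟩ h
    simp only [Finset.mem_sigma, Finset.mem_range] at h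
    rw [mem_flowEdges, hM.pathEdge_mult (mem_rootEdges.1 h.1).1 (Nat.le_of_lt_succ h.2)]
    exact (mem_rootEdges.1 h.1).1
  · rintro ⟨b, t⟩ h ⟨b', t'⟩ h' heq
    simp only [Finset.mem_sigma, Finset.mem_range] at h h'
    obtain ⟨rfl, rfl⟩ := hM.pathEdge_injective h.1 h'.1 (Nat.le_of_lt_succ h.2)
      (Nat.le_of_lt_succ h'.2) heq
    rfl
  · rintro ⟨i, j⟩ h
    rw [mem_flowEdges] at h
    obtain ⟨e, he, t, ht, hh⟩ := hM.exists_pathEdge h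
    exact ⟨⟨e, t⟩, by simpa [Nat.lt_succ_iff, ht] using he, hh⟩
  · intros; rfl

lemma prod_mult {α : Type*} [CommMonoid α] (φ : ℕ → α) :
    ∏ e ∈ flowEdges M, φ (M e.1 e.2) =
      ∏ b ∈ rootEdges M s z, φ (M b.1 b.2) ^ (pathLen M s z b + 1) := by
  rw [hM.prod_flowEdges]
  refine Finset.prod_congr rfl fun b hb => ?_
  rw [Finset.prod_congr rfl (g := fun _ => φ (M b.1 b.2))]
  · simp
  · intro t ht
    rw [hM.pathEdge_mult (mem_rootEdges.1 hb).1 (by simpa [Nat.lt_succ_iff] using ht)]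

lemma sum_rootEdges_mult :
    ∑ b ∈ rootEdges M s z, M b.1 b.2 * (pathLen M s z b + 1) = 2 * p := by
  have h := hM.prod_mult (fun m => Multiplicative.ofAdd m)
  have h2 : ∑ e ∈ flowEdges M, M e.1 e.2 =
      ∑ b ∈ rootEdges M s z, (pathLen M s z b + 1) • M b.1 b.2 := by
    apply Multiplicative.ofAdd.injective
    rw [ofAdd_sum, ofAdd_sum]
    simpa only [ofAdd_nsmul] using h
  rw [← hM.total, ← Fintype.sum_prod_type' (f := fun i j => M i j)]
  rw [flowEdges, Finset.sum_filter_ne_zero] at h2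
  rw [h2]
  refine Finset.sum_congr rfl fun b _ => ?_
  rw [smul_eq_mul, mul_comm]

/-- The weight of a flow is carried by its heavy vertices and its root edges. -/
lemma prod_weight (φ : ℕ → ℝ) (hφ : φ 0 = 1) :
    (∏ c, (outFlow M c : ℝ) ^ outFlow M c) *
        (∏ i, ∏ j, φ (M i j) / (M i j : ℝ) ^ M i j) =
      (∏ w ∈ heavyVerts M s z, (outFlow M w : ℝ) ^ outFlow M w) *
        ∏ b ∈ rootEdges M s z, φ (M b.1 b.2) ^ (pathLen M s z b + 1) / (M b.1 b.2 : ℝ) ^ M b.1 b.2 := by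
  classical
  set g : ℕ → ℝ := fun m => (m : ℝ) ^ m with hg
  have hg0 : ∀ m, g m ≠ 0 := by
    intro m
    rcases Nat.eq_zero_or_pos m with rfl | h
    · simp [hg]
    · exact pow_ne_zero _ (by positivity)
  have hE : ∏ i, ∏ j, φ (M i j) / g (M i j) = ∏ e ∈ flowEdges M, φ (M e.1 e.2) / g (M e.1 e.2) := by
    rw [← Fintype.prod_prod_type' (f := fun i j => φ (M i j) / g (M i j))]
    rw [flowEdges, Finset.prod_filter_of_ne]
    intro e _ h he
    exact h (by simp [he, hφ, hg])
  -- An edge with light tail is the only edge leaving that tail, so its multiplicity is the outflow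
  -- of the tail; these factors cancel those of the light vertices.
  have hsplit : ∏ e ∈ flowEdges M, g (M e.1 e.2) =
      (∏ b ∈ rootEdges M s z, g (M b.1 b.2)) *
        ∏ c ∈ (Finset.univ \ heavyVerts M s z), g (outFlow M c) := by
    have h1 : rootEdges M s z = (flowEdges M).filter (fun e => e.1 ∈ heavyVerts M s z) := by
      ext e; simp
    rw [h1, ← Finset.prod_filter_mul_prod_filter_not (flowEdges M)
      (fun e => e.1 ∈ heavyVerts M s z)]
    congr 1
    have h2 : ∏ c ∈ (Finset.univ \ heavyVerts M s z), g (outFlow M c) =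
        ∏ c ∈ (Finset.univ \ heavyVerts M s z).filter (fun c => outFlow M c ≠ 0),
          g (outFlow M c) := by
      rw [Finset.prod_filter_of_ne]
      intro c _ h hc
      exact h (by simp [hc, hg])
    rw [h2]
    refine Finset.prod_bij (fun e _ => e.1) ?_ ?_ ?_ ?_
    · intro e he
      simp only [Finset.mem_filter, mem_flowEdges, Finset.mem_sdiff, Finset.mem_univ,
        true_and] at he ⊢
      exact ⟨he.2, by rw [hM.light_outFlow he.2 he.1]; exact he.1⟩
    · intro e he e' he' h
      simp only [Finset.mem_filter, mem_flowEdges] at he he'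
      have : e.2 = e'.2 := hM.light_out_unique he.2 he.1 (by rw [h]; exact he'.1)
      exact Prod.ext h this
    · intro c hc
      simp only [Finset.mem_filter, Finset.mem_sdiff, Finset.mem_univ, true_and] at hc
      obtain ⟨j, -, hj⟩ := Finset.exists_ne_zero_of_sum_ne_zero hc.2
      exact ⟨(c, j), by simp [hj, hc.1], rfl⟩
    · intro e he
      simp only [Finset.mem_filter, mem_flowEdges] at he
      rw [hM.light_outFlow he.2 he.1]
  have hV : ∏ c, g (outFlow M c) = (∏ w ∈ heavyVerts M s z, g (outFlow M w)) *
      ∏ c ∈ (Finset.univ \ heavyVerts M s z), g (outFlow M c) := by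
    rw [mul_comm, Finset.prod_sdiff (Finset.subset_univ _)]
  change (∏ c, g (outFlow M c)) * (∏ i, ∏ j, φ (M i j) / g (M i j)) =
    (∏ w ∈ heavyVerts M s z, g (outFlow M w)) *
      ∏ b ∈ rootEdges M s z, φ (M b.1 b.2) ^ (pathLen M s z b + 1) / g (M b.1 b.2)
  rw [hE, hV, Finset.prod_div_distrib, Finset.prod_div_distrib, hsplit, hM.prod_mult φ]
  have n1 : ∏ b ∈ rootEdges M s z, g (M b.1 b.2) ≠ 0 := Finset.prod_ne_zero_iff.2 fun _ _ => hg0 _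
  have n2 : ∏ c ∈ (Finset.univ \ heavyVerts M s z), g (outFlow M c) ≠ 0 :=
    Finset.prod_ne_zero_iff.2 fun _ _ => hg0 _
  field_simp

end IsPairFlow

end Flow

/-! ### Degrees in a flow -/

section Degrees

set_option linter.unusedSectionVars false

variable {V : Type*} [Fintype V] [DecidableEq V] {M : V → V → ℕ} {s z : V} {p : ℕ}

namespace IsPairFlow

variable (hM : IsPairFlow p M s z)
include hM

/-- Passing from an edge with light head to the next edge preserves the multiplicity and is a
bijection onto the edges with light tail. The complements are the last and the first edges of the
paths. -/
lemma card_head_eq_card_tail (q : ℕ → Prop) [DecidablePred q] :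
    ((flowEdges M).filter fun e => q (M e.1 e.2) ∧ e.2 ∈ heavyVerts M s z).card =
      ((flowEdges M).filter fun e => q (M e.1 e.2) ∧ e.1 ∈ heavyVerts M s z).card := by
  have key : ((flowEdges M).filter fun e => q (M e.1 e.2) ∧ e.2 ∉ heavyVerts M s z).card =
      ((flowEdges M).filter fun e => q (M e.1 e.2) ∧ e.1 ∉ heavyVerts M s z).card := by
    refine Finset.card_bij (fun e _ => (e.2, nextVert M e.2)) ?_ ?_ ?_
    · intro e he
      simp only [Finset.mem_filter, mem_flowEdges] at he ⊢
      rw [hM.light_out_of_in he.2.2 he.1]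
      exact he
    · intro e he e' he' h
      simp only [Finset.mem_filter, mem_flowEdges] at he he'
      have h2 : e.2 = e'.2 := congrArg Prod.fst h
      exact Prod.ext (hM.light_in_unique he.2.2 he.1 (by rw [h2]; exact he'.1)) h2
    · rintro ⟨c, d⟩ he
      simp only [Finset.mem_filter, mem_flowEdges] at he
      obtain ⟨b, hb, hb0⟩ := hM.light_in_of_out he.2.2 he.1
      refine ⟨(b, c), by simpa [hb] using he, ?_⟩
      exact Prod.ext rfl (hM.light_out_unique he.2.2 (nextVert_spec he.1) he.1)
  have h1 := Finset.card_filter_add_card_filter_not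
    (s := (flowEdges M).filter fun e => q (M e.1 e.2)) (fun e => e.2 ∈ heavyVerts M s z)
  have h2 := Finset.card_filter_add_card_filter_not
    (s := (flowEdges M).filter fun e => q (M e.1 e.2)) (fun e => e.1 ∈ heavyVerts M s z)
  simp only [Finset.filter_filter] at h1 h2
  omega

omit hM in
lemma sum_card_out (q : ℕ → Prop) [DecidablePred q] :
    ∑ w ∈ heavyVerts M s z, ((outNbr M w).filter fun j => q (M w j)).card =
      ((rootEdges M s z).filter fun e => q (M e.1 e.2)).card := by
  rw [← Finset.card_sigma]
  refine Finset.card_bij (fun x _ => (x.1, x.2)) ?_ ?_ ?_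
  · rintro ⟨a, b⟩ h; simp [outNbr] at h ⊢; tauto
  · rintro ⟨a, b⟩ h ⟨a', b'⟩ h' heq; simpa using heq
  · rintro ⟨a, b⟩ h; simp only [Finset.mem_filter, mem_rootEdges] at h
    exact ⟨⟨a, b⟩, by simp [outNbr]; tauto, rfl⟩

lemma sum_card_in (q : ℕ → Prop) [DecidablePred q] :
    ∑ w ∈ heavyVerts M s z, ((inNbr M w).filter fun j => q (M j w)).card =
      ((rootEdges M s z).filter fun e => q (M e.1 e.2)).card := by
  have h1 : (rootEdges M s z).filter (fun e => q (M e.1 e.2)) =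
      (flowEdges M).filter fun e => q (M e.1 e.2) ∧ e.1 ∈ heavyVerts M s z := by
    ext e; simp; tauto
  rw [h1, ← hM.card_head_eq_card_tail, ← Finset.card_sigma]
  refine Finset.card_bij (fun x _ => (x.2, x.1)) ?_ ?_ ?_
  · rintro ⟨a, b⟩ h; simp [inNbr] at h ⊢; tauto
  · rintro ⟨a, b⟩ h ⟨a', b'⟩ h' heq; simp at heq ⊢; tauto
  · rintro ⟨a, b⟩ h; simp only [Finset.mem_filter, mem_flowEdges] at h
    exact ⟨⟨b, a⟩, by simp [inNbr]; tauto, rfl⟩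

lemma exists_edges : (∃ j, M s j ≠ 0) ∧ ∃ j, M j z ≠ 0 := by
  have h0 : ∑ i, ∑ j, M i j ≠ 0 := by have := hM.total; have := hM.pos; omega
  obtain ⟨i, -, hi⟩ := Finset.exists_ne_zero_of_sum_ne_zero h0
  obtain ⟨j, -, hj⟩ := Finset.exists_ne_zero_of_sum_ne_zero hi
  obtain ⟨T, x, t, htT, hx0, hxT, hstep, -⟩ := hM.walk i j hj
  refine ⟨⟨x 1, hx0 ▸ hstep 0 (by omega)⟩, ⟨x (T - 1), ?_⟩⟩
  have := hstep (T - 1) (by omega)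
  rwa [show T - 1 + 1 = T by omega, hxT] at this

lemma source_out_pos : 0 < (outNbr M s).card := by
  obtain ⟨j, hj⟩ := hM.exists_edges.1
  exact Finset.card_pos.2 ⟨j, by simpa [outNbr] using hj⟩

lemma sink_in_pos : 0 < (inNbr M z).card := by
  obtain ⟨j, hj⟩ := hM.exists_edges.2
  exact Finset.card_pos.2 ⟨j, by simpa [inNbr] using hj⟩

lemma heavy_out_pos {w : V} (hw : w ∈ heavyVerts M s z) (hz : w ≠ z) :
    0 < (outNbr M w).card := by
  by_cases hs : w = s
  · exact hs ▸ hM.source_out_pos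
  · have := hM.nbr_pos_iff hs hz
    simp only [heavyVerts, Finset.mem_filter, Finset.mem_univ, true_and, hs, hz, false_or] at hw
    omega

/-- The source and the sink may have degree 1; the terms 2 make up for that. -/
lemma heavy_degree {w : V} (hw : w ∈ heavyVerts M s z) :
    3 ≤ (outNbr M w).card + (inNbr M w).card + 2 * (if w = s then 1 else 0) +
      2 * (if w = z then 1 else 0) := by
  have h1 := hM.source_out_pos
  have h2 := hM.sink_in_pos
  by_cases hs : w = s
  · subst hs; simp only [if_true]; omega
  · by_cases hz : w = z
    · subst hz; simp only [if_true]; omega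
    · simp only [heavyVerts, Finset.mem_filter, Finset.mem_univ, true_and, hs, hz, false_or] at hw
      omega

/-- With degree d and d₂ double edges this says d₂ + 4 ≤ 2d away from the ends. It is clear from d ≥
3 if d₂ < d. If all edges are double, balance makes the in- and out-degrees equal, so d is even and
thus at least 4. -/
lemma heavy_degree_two {w : V} (hw : w ∈ heavyVerts M s z) :
    ((outNbr M w).filter fun j => M w j = 2).card + ((inNbr M w).filter fun j => M j w = 2).card + 4
      ≤ 2 * ((outNbr M w).card + (inNbr M w).card) + 3 * (if w = s then 1 else 0) +
        3 * (if w = z then 1 else 0) := by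
  have h1 := hM.source_out_pos
  have h2 := hM.sink_in_pos
  have h3 := Finset.card_filter_le (outNbr M w) (fun j => M w j = 2)
  have h4 := Finset.card_filter_le (inNbr M w) (fun j => M j w = 2)
  by_cases hs : w = s
  · subst hs; simp only [if_true]; split_ifs <;> omega
  · by_cases hz : w = z
    · subst hz; simp only [if_true, hs, if_false]; omega
    · have hw' := hw
      simp only [heavyVerts, Finset.mem_filter, Finset.mem_univ, true_and, hs, hz, false_or] at hw'
      simp only [hs, hz, if_false]
      by_contra hcon
      have e1 : ((outNbr M w).filter fun j => M w j = 2).card = (outNbr M w).card := by omega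
      have e2 : ((inNbr M w).filter fun j => M j w = 2).card = (inNbr M w).card := by omega
      rw [Finset.card_filter_eq_iff] at e1 e2
      have b := hM.balance_of_ne hs hz
      have b1 : ∑ j, M w j = (outNbr M w).card * 2 := by
        rw [← Finset.sum_filter_ne_zero]
        exact Finset.sum_const_nat e1
      have b2 : ∑ j, M j w = (inNbr M w).card * 2 := by
        rw [← Finset.sum_filter_ne_zero]
        exact Finset.sum_const_nat e2
      omega

omit hM in
lemma sum_source_indicator : ∑ w ∈ heavyVerts M s z, (if w = s then 1 else 0) = 1 := by
  simp [source_mem]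

omit hM in
lemma sum_sink_indicator : ∑ w ∈ heavyVerts M s z, (if w = z then 1 else 0) = 1 := by
  simp [sink_mem]

lemma three_mul_card_heavy_le :
    3 * (heavyVerts M s z).card ≤ 2 * (rootEdges M s z).card + 4 := by
  have h := Finset.sum_le_sum fun w (hw : w ∈ heavyVerts M s z) => hM.heavy_degree hw
  simp only [Finset.sum_add_distrib, ← Finset.mul_sum, sum_source_indicator, sum_sink_indicator,
    Finset.sum_const, smul_eq_mul] at h
  have h1 := sum_card_out (M := M) (s := s) (z := z) (fun _ => True)
  have h2 := hM.sum_card_in (fun _ => True)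
  simp only [Finset.filter_true] at h1 h2
  omega

/-- Summing `heavy_degree_two` counts each path twice, once at each end. With E double paths it
gives E - 1 ≤ 2(k + 1 - r), the source of the exponent of p². -/
lemma card_double_add_le :
    ((rootEdges M s z).filter fun e => M e.1 e.2 = 2).card + 2 * (heavyVerts M s z).card ≤
      2 * (rootEdges M s z).card + 3 := by
  have h := Finset.sum_le_sum fun w (hw : w ∈ heavyVerts M s z) => hM.heavy_degree_two hw
  simp only [Finset.sum_add_distrib, ← Finset.mul_sum, sum_source_indicator, sum_sink_indicator,
    Finset.sum_const, smul_eq_mul] at h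
  have h1 := sum_card_out (M := M) (s := s) (z := z) (fun _ => True)
  have h2 := hM.sum_card_in (fun _ => True)
  have h3 := sum_card_out (M := M) (s := s) (z := z) (fun m => m = 2)
  have h4 := hM.sum_card_in (fun m => m = 2)
  simp only [Finset.filter_true] at h1 h2
  omega

/-- Every heavy vertex other than the sink has an outgoing edge, so at least r - 1 paths exist; the
hypothesis supplies one more. -/
lemma card_heavy_le (h : 0 < (outNbr M z).card ∨ ∃ c, 1 < (outNbr M c).card) :
    (heavyVerts M s z).card ≤ (rootEdges M s z).card := by
  have h1 := sum_card_out (M := M) (s := s) (z := z) (fun _ => True)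
  simp only [Finset.filter_true] at h1
  rw [← h1, Finset.card_eq_sum_ones]
  by_cases hz : 0 < (outNbr M z).card
  · refine Finset.sum_le_sum fun w hw => ?_
    by_cases hwz : w = z
    · exact hwz ▸ hz
    · exact hM.heavy_out_pos hw hwz
  · obtain ⟨c, hc⟩ := h.resolve_left hz
    have hcH : c ∈ heavyVerts M s z := by
      by_contra hcH
      have := hM.light_card hcH (Or.inl (by omega))
      omega
    have hcz : c ≠ z := by rintro rfl; omega
    have : ∑ w ∈ heavyVerts M s z, (1 + if w = c then 1 else 0) ≤
        ∑ w ∈ heavyVerts M s z, ((outNbr M w).card + if w = z then 1 else 0) := by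
      refine Finset.sum_le_sum fun w hw => ?_
      by_cases hwz : w = z
      · subst hwz; simp [hcz.symm]
      · have := hM.heavy_out_pos hw hwz
        by_cases hwc : w = c
        · subst hwc; simp only [hwz, if_true, if_false]; omega
        · simp only [hwz, hwc, if_false]; omega
    rw [Finset.sum_add_distrib, Finset.sum_add_distrib, sum_sink_indicator] at this
    simp only [Finset.sum_ite_eq', hcH, if_true] at this
    omega

omit hM in
lemma outFlow_eq_sum_rootEdges {w : V} (hw : w ∈ heavyVerts M s z) :
    outFlow M w = ∑ b ∈ (rootEdges M s z).filter (fun b => b.1 = w), M b.1 b.2 := by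
  rw [outFlow, ← Finset.sum_filter_ne_zero]
  refine Finset.sum_bij (fun j _ => (w, j)) ?_ ?_ ?_ ?_
  · intro j hj; simpa [hw] using hj
  · intro j _ j' _ h; simpa using h
  · rintro ⟨a, j⟩ h
    simp only [Finset.mem_filter, mem_rootEdges] at h
    obtain ⟨⟨h1, -⟩, rfl⟩ := h
    exact ⟨j, by simpa using h1, rfl⟩
  · intros; rfl

lemma two_le_mult {e : V × V} (he : M e.1 e.2 ≠ 0) : 2 ≤ M e.1 e.2 := by
  have := hM.ne_one e.1 e.2; omega

lemma mult_mul_le {e : V × V} (he : e ∈ rootEdges M s z) :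
    M e.1 e.2 * (pathLen M s z e + 1) ≤ 2 * p := by
  rw [← hM.sum_rootEdges_mult]
  exact Finset.single_le_sum (f := fun e : V × V => M e.1 e.2 * (pathLen M s z e + 1))
    (fun _ _ => Nat.zero_le _) he

lemma mult_lt {e : V × V} (he : e ∈ rootEdges M s z) : M e.1 e.2 < 2 * p + 1 := by
  have := hM.mult_mul_le he
  nlinarith

lemma pathLen_lt {e : V × V} (he : e ∈ rootEdges M s z) : pathLen M s z e < p := by
  have := hM.mult_mul_le he
  have := hM.two_le_mult (mem_rootEdges.1 he).1
  nlinarith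

end IsPairFlow

end Degrees

/-! ### Encoding of flows by their heavy vertices and root edges -/

section Code

set_option linter.unusedSectionVars false

variable {V : Type*} [Fintype V] [DecidableEq V]

variable (V) in
/-- Codes of flows: labels of `r` heavy vertices, the indices of source and sink, and for each of
`k` paths its multiplicity, its tail, its head, its number of interior vertices and their labels. -/
abbrev FlowCode (p k r : ℕ) : Type _ :=
  (Fin r → V) × (Fin r × Fin r) × (Fin k → Fin (2 * p + 1)) × (Fin k → Fin r) × (Fin k → Fin r) ×
    (Σ l : Fin k → Fin p, ∀ b, Fin (l b) → V)

namespace FlowCode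

variable {p k r : ℕ}

/-- The labels of the heavy vertices. -/
def label (d : FlowCode V p k r) : Fin r → V := d.1
/-- The index of the source. -/
def src (d : FlowCode V p k r) : Fin r := d.2.1.1
/-- The index of the sink. -/
def snk (d : FlowCode V p k r) : Fin r := d.2.1.2
/-- The multiplicities of the paths. -/
def mult (d : FlowCode V p k r) : Fin k → Fin (2 * p + 1) := d.2.2.1
/-- The tails of the paths. -/
def tail (d : FlowCode V p k r) : Fin k → Fin r := d.2.2.2.1
/-- The heads of the paths. -/
def head (d : FlowCode V p k r) : Fin k → Fin r := d.2.2.2.2.1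
/-- The numbers of interior vertices of the paths. -/
def len (d : FlowCode V p k r) : Fin k → Fin p := d.2.2.2.2.2.1
/-- The interior vertices of the paths. -/
def inner (d : FlowCode V p k r) : ∀ b, Fin (d.len b) → V := d.2.2.2.2.2.2

/-- The vertices of the path number `b`. -/
def vert (d : FlowCode V p k r) (b : Fin k) : ℕ → V
  | 0 => d.label (d.tail b)
  | i + 1 => if h : i < d.len b then d.inner b ⟨i, h⟩ else d.label (d.head b)

/-- The conditions satisfied by the multiplicities, the tails, the sink and the lengths in a code
of a flow. -/
structure IsAdmissible (z : Fin r) (m : Fin k → Fin (2 * p + 1)) (tl : Fin k → Fin r)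
    (l : Fin k → Fin p) : Prop where
  two_le : ∀ b, 2 ≤ (m b : ℕ)
  total : ∑ b, (m b : ℕ) * ((l b : ℕ) + 1) = 2 * p
  tail_surj : ∀ w, w ≠ z → ∃ b, tl b = w
  double : (Finset.univ.filter fun b => (m b : ℕ) = 2).card + 2 * r ≤ 2 * k + 3

end FlowCode

variable (V) in
/-- The type of flows with source and sink. -/
abbrev PairFlow (p : ℕ) : Type _ :=
  {x : (V → V → ℕ) × V × V // IsPairFlow p x.1 x.2.1 x.2.2}

/-! ### Encoding flows with enumerated heavy vertices and root edges -/

namespace PairFlow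

variable {p k r : ℕ}

/-- The heavy vertices of a flow. -/
def heavy (f : PairFlow V p) : Finset V := heavyVerts f.1.1 f.1.2.1 f.1.2.2

/-- The root edges of a flow. -/
def root (f : PairFlow V p) : Finset (V × V) := rootEdges f.1.1 f.1.2.1 f.1.2.2

/-- The code of a flow, for given enumerations of its heavy vertices and root edges. -/
noncomputable def encode (f : PairFlow V p) (eH : Fin r ≃ {x // x ∈ f.heavy})
    (eB : Fin k ≃ {x // x ∈ f.root}) : FlowCode V p k r :=
  (fun w => (eH w).1,
    (eH.symm ⟨f.1.2.1, IsPairFlow.source_mem⟩, eH.symm ⟨f.1.2.2, IsPairFlow.sink_mem⟩),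
    fun b => ⟨f.1.1 (eB b).1.1 (eB b).1.2, f.2.mult_lt (eB b).2⟩,
    fun b => eH.symm ⟨(eB b).1.1, (mem_rootEdges.1 (eB b).2).2⟩,
    fun b => eH.symm ⟨_, f.2.pathLen_mem (mem_rootEdges.1 (eB b).2).1⟩,
    ⟨fun b => ⟨pathLen f.1.1 f.1.2.1 f.1.2.2 (eB b).1, f.2.pathLen_lt (eB b).2⟩,
      fun b i => pathVert f.1.1 (eB b).1 (i + 1)⟩)

variable (f : PairFlow V p) (eH : Fin r ≃ {x // x ∈ f.heavy}) (eB : Fin k ≃ {x // x ∈ f.root})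

lemma encode_len (b : Fin k) :
    ((f.encode eH eB).len b : ℕ) = pathLen f.1.1 f.1.2.1 f.1.2.2 (eB b).1 := rfl

lemma encode_mult (b : Fin k) :
    ((f.encode eH eB).mult b : ℕ) = f.1.1 (eB b).1.1 (eB b).1.2 := rfl

lemma encode_vert (b : Fin k) {i : ℕ} (hi : i ≤ pathLen f.1.1 f.1.2.1 f.1.2.2 (eB b).1 + 1) :
    (f.encode eH eB).vert b i = pathVert f.1.1 (eB b).1 i := by
  cases i with
  | zero => simp [FlowCode.vert, FlowCode.label, FlowCode.tail, encode, pathVert]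
  | succ i =>
    by_cases h : i < pathLen f.1.1 f.1.2.1 f.1.2.2 (eB b).1
    · have h' : i < (f.encode eH eB).len b := h
      simp only [FlowCode.vert, dif_pos h']
      rfl
    · have h' : ¬ i < (f.encode eH eB).len b := h
      simp only [FlowCode.vert, dif_neg h']
      have : i = pathLen f.1.1 f.1.2.1 f.1.2.2 (eB b).1 := by omega
      simp [FlowCode.label, FlowCode.head, encode, this]

lemma mult_of_encode_eq {f f' : PairFlow V p} {eH : Fin r ≃ {x // x ∈ f.heavy}}
    {eB : Fin k ≃ {x // x ∈ f.root}} {eH' : Fin r ≃ {x // x ∈ f'.heavy}}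
    {eB' : Fin k ≃ {x // x ∈ f'.root}} (h : f.encode eH eB = f'.encode eH' eB') {i j : V}
    (hij : f.1.1 i j ≠ 0) : f.1.1 i j = f'.1.1 i j := by
  obtain ⟨e, he, t, ht, hte⟩ := f.2.exists_pathEdge hij
  obtain ⟨b, hb⟩ := eB.surjective ⟨e, he⟩
  have hb1 : (eB b).1 = e := by rw [hb]
  have hl : pathLen f.1.1 f.1.2.1 f.1.2.2 (eB b).1 = pathLen f'.1.1 f'.1.2.1 f'.1.2.2 (eB' b).1 := by
    rw [← encode_len f eH eB, ← encode_len f' eH' eB', h]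
  have hm : f.1.1 (eB b).1.1 (eB b).1.2 = f'.1.1 (eB' b).1.1 (eB' b).1.2 := by
    rw [← encode_mult f eH eB, ← encode_mult f' eH' eB', h]
  have hv : ∀ i ≤ pathLen f.1.1 f.1.2.1 f.1.2.2 (eB b).1 + 1,
      pathVert f.1.1 (eB b).1 i = pathVert f'.1.1 (eB' b).1 i := by
    intro i hi
    rw [← encode_vert f eH eB b hi, ← encode_vert f' eH' eB' b (hl ▸ hi), h]
  rw [← hb1] at ht hte
  have hpe : pathEdge f'.1.1 (eB' b).1 t = (i, j) := by
    rw [← hte]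
    simp only [pathEdge, hv t (by omega), hv (t + 1) (by omega)]
  have m1 := f.2.pathEdge_mult (mem_rootEdges.1 (eB b).2).1 ht
  have m2 := f'.2.pathEdge_mult (mem_rootEdges.1 (eB' b).2).1 (hl ▸ ht)
  rw [hte] at m1
  rw [hpe] at m2
  exact m1.trans (hm.trans m2.symm)

lemma encode_injective {f f' : PairFlow V p} {eH : Fin r ≃ {x // x ∈ f.heavy}}
    {eB : Fin k ≃ {x // x ∈ f.root}} {eH' : Fin r ≃ {x // x ∈ f'.heavy}}
    {eB' : Fin k ≃ {x // x ∈ f'.root}} (h : f.encode eH eB = f'.encode eH' eB') :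
    (⟨f, eH, eB⟩ : Σ f : PairFlow V p, (Fin r ≃ {x // x ∈ f.heavy}) × (Fin k ≃ {x // x ∈ f.root}))
      = ⟨f', eH', eB'⟩ := by
  have hff : f = f' := by
    apply Subtype.ext
    refine Prod.ext ?_ (Prod.ext ?_ ?_)
    · funext i j
      by_cases hij : f.1.1 i j = 0
      · by_cases hij' : f'.1.1 i j = 0
        · rw [hij, hij']
        · exact (mult_of_encode_eq h.symm hij').symm
      · exact mult_of_encode_eq h hij
    · have h1 := congrArg (fun d : FlowCode V p k r => d.label d.src) h
      simpa [FlowCode.label, FlowCode.src, encode] using h1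
    · have h1 := congrArg (fun d : FlowCode V p k r => d.label d.snk) h
      simpa [FlowCode.label, FlowCode.snk, encode] using h1
  subst hff
  congr 2
  · ext w
    exact congrFun (congrArg FlowCode.label h) w
  -- A root edge is recovered from the vertices 0 and 1 of its path.
  · ext b : 2
    have h0 := encode_vert f eH eB b (i := 0) (by omega)
    have h1 := encode_vert f eH eB b (i := 1) (by omega)
    rw [h, encode_vert f eH' eB' b (by omega)] at h0 h1
    exact Prod.ext h0.symm h1.symm

lemma encode_isAdmissible : FlowCode.IsAdmissible (f.encode eH eB).snk (f.encode eH eB).mult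
    (f.encode eH eB).tail (f.encode eH eB).len where
  two_le b := f.2.two_le_mult (mem_rootEdges.1 (eB b).2).1
  total := by
    refine Eq.trans ?_ f.2.sum_rootEdges_mult
    have := Equiv.sum_comp eB (fun e => f.1.1 e.1.1 e.1.2 * (pathLen f.1.1 f.1.2.1 f.1.2.2 e.1 + 1))
    refine this.trans ?_
    exact Finset.sum_coe_sort f.root
      (fun e => f.1.1 e.1 e.2 * (pathLen f.1.1 f.1.2.1 f.1.2.2 e + 1))
  tail_surj w hw := by
    have hz : (eH w).1 ≠ f.1.2.2 := by
      intro h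
      apply hw
      rw [FlowCode.snk, encode]
      simp only
      rw [Equiv.eq_symm_apply]
      exact Subtype.ext h
    obtain ⟨j, hj⟩ := Finset.card_pos.1 (f.2.heavy_out_pos (eH w).2 hz)
    have hj' : f.1.1 (eH w).1 j ≠ 0 := by simpa [outNbr] using hj
    refine ⟨eB.symm ⟨((eH w).1, j), mem_rootEdges.2 ⟨hj', (eH w).2⟩⟩, ?_⟩
    simp [FlowCode.tail, encode]
  double := by
    have h := f.2.card_double_add_le
    have hr : f.heavy.card = r := by
      have := Fintype.card_congr eH; simpa using this.symm
    have hk : f.root.card = k := by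
      have := Fintype.card_congr eB; simpa using this.symm
    change _ + 2 * f.heavy.card ≤ 2 * f.root.card + 3 at h
    rw [hr, hk] at h
    refine le_trans (Nat.add_le_add_right (le_of_eq ?_) _) h
    refine Finset.card_bij (fun b _ => (eB b).1) ?_ ?_ ?_
    · intro b hb
      have hb' : f.1.1 (eB b).1.1 (eB b).1.2 = 2 := (Finset.mem_filter.1 hb).2
      exact Finset.mem_filter.2 ⟨(eB b).2, hb'⟩
    · intro b _ b' _ h
      exact eB.injective (Subtype.ext h)
    · intro e he
      obtain ⟨h1, h2⟩ := Finset.mem_filter.1 he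
      refine ⟨eB.symm ⟨e, h1⟩, Finset.mem_filter.2 ⟨Finset.mem_univ _, ?_⟩, by simp⟩
      rw [encode_mult]
      simpa using h2

/-- The weight of a flow. -/
noncomputable def weight (φ : ℕ → ℝ) (f : PairFlow V p) : ℝ :=
  (∏ c, (outFlow f.1.1 c : ℝ) ^ outFlow f.1.1 c) *
    ∏ i, ∏ j, φ (f.1.1 i j) / (f.1.1 i j : ℝ) ^ f.1.1 i j

/-- The weight of a flow in terms of the multiplicities, the tails and the lengths in its code. -/
noncomputable def codeWeight (φ : ℕ → ℝ) (m : Fin k → Fin (2 * p + 1)) (tl : Fin k → Fin r)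
    (l : Fin k → Fin p) : ℝ :=
  (∏ w, ((∑ b with tl b = w, (m b : ℕ) : ℕ) : ℝ) ^ (∑ b with tl b = w, (m b : ℕ))) *
    ∏ b, φ (m b) ^ ((l b : ℕ) + 1) / ((m b : ℕ) : ℝ) ^ (m b : ℕ)

lemma weight_eq_codeWeight (φ : ℕ → ℝ) (hφ : φ 0 = 1) :
    f.weight φ = codeWeight φ (f.encode eH eB).mult (f.encode eH eB).tail (f.encode eH eB).len := by
  rw [weight, f.2.prod_weight φ hφ, codeWeight]
  congr 1
  · rw [← Finset.prod_coe_sort]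
    refine (Equiv.prod_comp eH (fun i => (outFlow f.1.1 i.1 : ℝ) ^ outFlow f.1.1 i.1)).symm.trans ?_
    refine Finset.prod_congr rfl fun w _ => ?_
    have : outFlow f.1.1 (eH w).1 =
        ∑ b with (f.encode eH eB).tail b = w, ((f.encode eH eB).mult b : ℕ) := by
      rw [IsPairFlow.outFlow_eq_sum_rootEdges (eH w).2]
      symm
      refine Finset.sum_bij (fun b _ => (eB b).1) ?_ ?_ ?_ ?_
      · intro b hb
        have hb' : eH.symm ⟨(eB b).1.1, (mem_rootEdges.1 (eB b).2).2⟩ = w := (Finset.mem_filter.1 hb).2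
        refine Finset.mem_filter.2 ⟨(eB b).2, ?_⟩
        rw [← hb']; simp
      · intro b _ b' _ h
        exact eB.injective (Subtype.ext h)
      · intro e he
        obtain ⟨h1, h2⟩ := Finset.mem_filter.1 he
        refine ⟨eB.symm ⟨e, h1⟩, Finset.mem_filter.2 ⟨Finset.mem_univ _, ?_⟩, by simp⟩
        simp [FlowCode.tail, encode, h2]
      · intros; rfl
    rw [this]
  · rw [← Finset.prod_coe_sort]
    exact (Equiv.prod_comp eB (fun e => φ (f.1.1 e.1.1 e.1.2) ^
      (pathLen f.1.1 f.1.2.1 f.1.2.2 e.1 + 1) /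
        (f.1.1 e.1.1 e.1.2 : ℝ) ^ f.1.1 e.1.1 e.1.2)).symm

-- Each flow has r! k! pairs of enumerations, all with the same weight, and the code determines both
-- the flow and the enumerations.
open Classical in
lemma sum_weight_le (φ : ℕ → ℝ) (hφ : φ 0 = 1) (hφn : ∀ m, 0 ≤ φ m) (S : Finset (PairFlow V p))
    (hr : ∀ f ∈ S, f.heavy.card = r) (hk : ∀ f ∈ S, f.root.card = k) :
    (r.factorial * k.factorial : ℝ) * ∑ f ∈ S, f.weight φ ≤
      ∑ d : FlowCode V p k r, if FlowCode.IsAdmissible d.snk d.mult d.tail d.len then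
        codeWeight φ d.mult d.tail d.len else 0 := by
  set F : FlowCode V p k r → ℝ := fun d =>
    if FlowCode.IsAdmissible d.snk d.mult d.tail d.len then codeWeight φ d.mult d.tail d.len else 0
  have hF : ∀ d, 0 ≤ F d := by
    intro d
    simp only [F]
    split_ifs
    · unfold codeWeight
      refine mul_nonneg (Finset.prod_nonneg fun _ _ => by positivity)
        (Finset.prod_nonneg fun _ _ => ?_)
      have := hφn (d.mult ‹_›)
      positivity
    · exact le_rfl
  have h1 : (r.factorial * k.factorial : ℝ) * ∑ f ∈ S, f.weight φ =
      ∑ x ∈ S.sigma (fun f => (Finset.univ :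
        Finset ((Fin r ≃ {x // x ∈ f.heavy}) × (Fin k ≃ {x // x ∈ f.root})))),
        F (x.1.encode x.2.1 x.2.2) := by
    rw [Finset.sum_sigma, Finset.mul_sum]
    refine Finset.sum_congr rfl fun f hf => ?_
    have hc : Fintype.card ((Fin r ≃ {x // x ∈ f.heavy}) × (Fin k ≃ {x // x ∈ f.root})) =
        r.factorial * k.factorial := by
      have eH : Fin r ≃ {x // x ∈ f.heavy} := (Fintype.equivFinOfCardEq (by simp [hr f hf])).symm
      have eB : Fin k ≃ {x // x ∈ f.root} := (Fintype.equivFinOfCardEq (by simp [hk f hf])).symm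
      rw [Fintype.card_prod, Fintype.card_equiv eH, Fintype.card_equiv eB]
      simp
    rw [Finset.sum_congr rfl (g := fun _ => f.weight φ)]
    · rw [Finset.sum_const, Finset.card_univ, hc]
      simp
    · intro e _
      simp only [F]
      rw [if_pos (f.encode_isAdmissible e.1 e.2), ← f.weight_eq_codeWeight e.1 e.2 φ hφ]
  rw [h1, ← Finset.sum_image (f := F)
    (g := fun x : (Σ f : PairFlow V p, (Fin r ≃ {x // x ∈ f.heavy}) × (Fin k ≃ {x // x ∈ f.root})) =>
      x.1.encode x.2.1 x.2.2)]
  · exact Finset.sum_le_sum_of_subset_of_nonneg (Finset.subset_univ _) fun d _ _ => hF d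
  · rintro ⟨f, eH, eB⟩ _ ⟨f', eH', eB'⟩ _ h
    exact encode_injective h

end PairFlow

end Code

/-! ### Elementary counting bounds -/

section Counting

open scoped Nat

/-- The base `x` need not be comparable to `j`. Taking x = k in every use turns all factorials into
powers of the same `k`, at the cost of e^k. -/
lemma inv_factorial_le_exp_mul_inv_pow {x : ℝ} (hx : 0 < x) (j : ℕ) :
    ((j ! : ℝ))⁻¹ ≤ Real.exp x * (x ^ j)⁻¹ := by
  have h := Real.pow_div_factorial_le_exp x hx.le j
  have hp : 0 < x ^ j := by positivity
  rw [← div_eq_mul_inv, le_div_iff₀ hp]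
  rwa [div_eq_inv_mul] at h

/-- Here `t` is the outflow of a heavy vertex with `o` outgoing paths. Each path has multiplicity at
least 2, so t^(2o) is split off and bounded by t^o ≤ e^t o!; only the excess multiplicity costs
powers of `p`. -/
lemma nat_pow_self_le (t o p : ℕ) (h1 : 2 * o ≤ t) (h2 : t ≤ 2 * p) :
    (t : ℝ) ^ t ≤ (2 * p : ℝ) ^ (t - 2 * o) * Real.exp 1 ^ (2 * t) * (o ! : ℝ) ^ 2 := by
  have h := Real.pow_div_factorial_le_exp (t : ℝ) (by positivity) o
  rw [div_le_iff₀ (by positivity)] at h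
  have e1 : Real.exp 1 ^ (2 * t) = Real.exp t ^ 2 := by
    rw [← Real.exp_nat_mul, ← Real.exp_nat_mul]; congr 1; push_cast; ring
  have e2 : (t : ℝ) ^ t = (t : ℝ) ^ (t - 2 * o) * ((t : ℝ) ^ o) ^ 2 := by
    rw [← pow_mul, ← pow_add]; congr 1; omega
  rw [e2, e1, mul_assoc, ← mul_pow]
  have h3 : (t : ℝ) ≤ 2 * p := by exact_mod_cast h2
  gcongr

/-- The number of solutions of a linear equation in bounded natural numbers. -/
lemma card_sum_eq_le {ι : Type*} [Fintype ι] [DecidableEq ι] (p X : ℕ) :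
    ((Finset.univ.filter fun a : ι → Fin p => ∑ b, 2 * ((a b : ℕ) + 1) + X = 2 * p).card : ℝ) ≤
      (p : ℝ) ^ (Fintype.card ι - 1) / ((Fintype.card ι - 1)! : ℝ) := by
  rcases isEmpty_or_nonempty ι with hι | hι
  · have h1 : (Finset.univ.filter fun a : ι → Fin p =>
        ∑ b, 2 * ((a b : ℕ) + 1) + X = 2 * p).card ≤ 1 :=
      (Finset.card_le_univ _).trans (by simp)
    have : Fintype.card ι = 0 := Fintype.card_eq_zero
    simpa [this] using h1
  set E := Fintype.card ι with hE
  have hE0 : 0 < E := Fintype.card_pos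
  set N := p - X / 2 - E
  have h1 : (Finset.univ.filter fun a : ι → Fin p =>
      ∑ b, 2 * ((a b : ℕ) + 1) + X = 2 * p).card ≤
        ((Finset.univ : Finset ι).finsuppAntidiag N).card := by
    refine Finset.card_le_card_of_injOn
      (fun a => Finsupp.equivFunOnFinite.symm fun b => (a b : ℕ)) ?_ ?_
    · intro a ha
      have ha' : ∑ b, 2 * ((a b : ℕ) + 1) + X = 2 * p := by simpa using ha
      have hs : ∑ b : ι, ((a b : ℕ) + 1) = ∑ b, (a b : ℕ) + E := by
        rw [Finset.sum_add_distrib]; simp [hE]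
      rw [← Finset.mul_sum, hs] at ha'
      simp only [Finset.mem_coe, Finset.mem_finsuppAntidiag,
        Finset.subset_univ, and_true, Finsupp.equivFunOnFinite_symm_apply_apply]
      omega
    · intro a _ a' _ h
      funext b
      have := DFunLike.congr_fun h b
      exact Fin.ext (by simpa using this)
  rw [Finset.card_finsuppAntidiag_nat_eq_choose, Finset.card_univ] at h1
  -- A solution is needed for E + N - 1 ≤ p, since the subtraction in `N` is truncated.
  by_cases h0 : (Finset.univ.filter fun a : ι → Fin p =>
      ∑ b, 2 * ((a b : ℕ) + 1) + X = 2 * p).card = 0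
  · rw [h0]; push_cast; positivity
  obtain ⟨a, ha⟩ := Finset.card_pos.1 (Nat.pos_of_ne_zero h0)
  have ha' : ∑ b, 2 * ((a b : ℕ) + 1) + X = 2 * p := by simpa using ha
  have hs : ∑ b : ι, ((a b : ℕ) + 1) = ∑ b, (a b : ℕ) + E := by
    rw [Finset.sum_add_distrib]; simp [hE]
  rw [← Finset.mul_sum, hs] at ha'
  have hle : E + N - 1 ≤ p := by omega
  have hch : (E + N - 1).choose N = (E + N - 1).choose (E - 1) := by
    rw [← Nat.choose_symm (by omega : N ≤ E + N - 1)]; congr 1; omega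
  rw [← hE, hch] at h1
  calc _ ≤ ((E + N - 1).choose (E - 1) : ℝ) := by exact_mod_cast h1
    _ ≤ ((E + N - 1 : ℕ) : ℝ) ^ (E - 1) / ((E - 1)! : ℝ) := Nat.choose_le_pow_div _ _
    _ ≤ _ := by gcongr

lemma sum_fin_geometric_le (p : ℕ) {x : ℝ} (hx : 0 ≤ x) (hx1 : x ≤ 1 / 2) :
    ∑ i : Fin p, x ^ (i : ℕ) ≤ 2 := by
  rw [← Finset.sum_range (fun i => x ^ i)]
  refine le_trans (Finset.sum_le_sum fun i _ => pow_le_pow_left₀ hx hx1 i) (sum_geometric_two_le p)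

/-- Summation over the lengths of `k` paths of multiplicities `m`, where the paths of multiplicity
at least three carry a geometric weight. -/
lemma sum_lengths_le {p k : ℕ} (m : Fin k → ℕ) :
    ∑ l : Fin k → Fin p, (if ∑ b, m b * ((l b : ℕ) + 1) = 2 * p then
        ∏ b, (if m b = 2 then (1 : ℝ) else (1 / 2) ^ (l b : ℕ)) else 0) ≤
      2 ^ k * ((p : ℝ) ^ ((Finset.univ.filter fun b => m b = 2).card - 1) /
        (((Finset.univ.filter fun b => m b = 2).card - 1)! : ℝ)) := by
  classical
  set P : Fin k → Prop := fun b => m b = 2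
  set e := Equiv.piEquivPiSubtypeProd P (fun _ => Fin p)
  have hE : (Finset.univ.filter fun b => m b = 2).card = Fintype.card {b // P b} :=
    (Fintype.card_subtype _).symm
  rw [hE, ← Equiv.sum_comp e.symm, Fintype.sum_prod_type_right]
  set Q := (p : ℝ) ^ (Fintype.card {b // P b} - 1) / ((Fintype.card {b // P b} - 1)! : ℝ)
  have e1 : ∀ (a : {b // P b} → Fin p) (c : {b // ¬ P b} → Fin p) (b : {b // P b}),
      e.symm (a, c) b = a b := by
    intro a c b; simp [e, Equiv.piEquivPiSubtypeProd, b.2]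
  have e2 : ∀ (a : {b // P b} → Fin p) (c : {b // ¬ P b} → Fin p) (b : {b // ¬ P b}),
      e.symm (a, c) b = c b := by
    intro a c b; simp [e, Equiv.piEquivPiSubtypeProd, b.2]
  -- Once the lengths of the other paths are fixed, those of the double paths solve one linear
  -- equation.
  have step : ∀ c : {b // ¬ P b} → Fin p,
      ∑ a : {b // P b} → Fin p,
        (if ∑ b, m b * ((e.symm (a, c) b : ℕ) + 1) = 2 * p then
          ∏ b, (if m b = 2 then (1 : ℝ) else (1 / 2) ^ (e.symm (a, c) b : ℕ)) else 0) ≤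
        Q * ∏ b, (1 / 2 : ℝ) ^ (c b : ℕ) := by
    intro c
    have s1 : ∀ a : {b // P b} → Fin p, ∑ b, m b * ((e.symm (a, c) b : ℕ) + 1) =
        ∑ b, 2 * ((a b : ℕ) + 1) + ∑ b : {b // ¬ P b}, m b * ((c b : ℕ) + 1) := by
      intro a
      rw [← Fintype.sum_subtype_add_sum_subtype P]
      congr 1
      · exact Finset.sum_congr rfl fun b _ => by rw [e1, show m b = 2 from b.2]
      · exact Finset.sum_congr rfl fun b _ => by rw [e2]
    have s2 : ∀ a : {b // P b} → Fin p,
        ∏ b, (if m b = 2 then (1 : ℝ) else (1 / 2) ^ (e.symm (a, c) b : ℕ)) =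
          ∏ b, (1 / 2 : ℝ) ^ (c b : ℕ) := by
      intro a
      rw [← Fintype.prod_subtype_mul_prod_subtype P]
      rw [Finset.prod_eq_one (fun b _ => if_pos b.2), one_mul]
      exact Finset.prod_congr rfl fun b _ => by rw [e2, if_neg b.2]
    simp only [s1, s2]
    rw [← Finset.sum_filter, Finset.sum_const, nsmul_eq_mul]
    refine mul_le_mul_of_nonneg_right (card_sum_eq_le p _) (Finset.prod_nonneg fun _ _ => by positivity)
  refine (Finset.sum_le_sum fun c _ => step c).trans ?_
  rw [← Finset.mul_sum, mul_comm]
  refine mul_le_mul_of_nonneg_right ?_ (by positivity)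
  rw [← Fintype.prod_sum (fun _ (j : Fin p) => (1 / 2 : ℝ) ^ (j : ℕ))]
  calc ∏ _b : {b // ¬ P b}, ∑ j : Fin p, (1 / 2 : ℝ) ^ (j : ℕ) ≤ ∏ _b : {b // ¬ P b}, 2 :=
        Finset.prod_le_prod (fun _ _ => Finset.sum_nonneg fun _ _ => by positivity)
          fun _ _ => sum_fin_geometric_le p (by norm_num) le_rfl
    _ = 2 ^ Fintype.card {b // ¬ P b} := by simp
    _ ≤ 2 ^ k := by
        refine pow_le_pow_right₀ (by norm_num) ?_
        exact (Fintype.card_subtype_le _).trans (by simp)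

/-- Both sides count the ways to distribute `k` labelled objects into `r` ordered lists: a new
object has r + k places. -/
lemma sum_prod_factorial_fiber (r k : ℕ) :
    ∑ tl : Fin k → Fin r, ∏ w, ((Finset.univ.filter fun b => tl b = w).card)! =
      r.ascFactorial k := by
  induction k with
  | zero => simp
  | succ k ih =>
    rw [← Equiv.sum_comp (Fin.consEquiv fun _ => Fin r), Fintype.sum_prod_type_right,
      Nat.ascFactorial_succ, ← ih, Finset.mul_sum]
    refine Finset.sum_congr rfl fun tl _ => ?_
    have h1 : ∀ a w : Fin r, (Finset.univ.filter fun b => (Fin.consEquiv fun _ => Fin r) (a, tl) b = w).card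
        = (Finset.univ.filter fun b => tl b = w).card + if a = w then 1 else 0 := by
      intro a w
      rw [Finset.card_filter, Fin.sum_univ_succ, Finset.card_filter, add_comm]
      rfl
    have h2 : ∀ a : Fin r, ∏ w, ((Finset.univ.filter fun b =>
        (Fin.consEquiv fun _ => Fin r) (a, tl) b = w).card)! =
        ((Finset.univ.filter fun b => tl b = a).card + 1) *
          ∏ w, ((Finset.univ.filter fun b => tl b = w).card)! := by
      intro a
      rw [← Finset.mul_prod_erase _ _ (Finset.mem_univ a),
        ← Finset.mul_prod_erase _ (fun w => ((Finset.univ.filter fun b => tl b = w).card)!)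
          (Finset.mem_univ a), h1, if_pos rfl, Nat.factorial_succ, mul_assoc]
      congr 2
      refine Finset.prod_congr rfl fun w hw => ?_
      rw [h1, if_neg (Finset.ne_of_mem_erase hw).symm, add_zero]
    rw [Finset.sum_congr rfl fun a _ => h2 a, ← Finset.sum_mul, Finset.sum_add_distrib]
    congr 1
    rw [Finset.sum_card_fiberwise_eq_card_filter]
    simp [add_comm]

/-- Use o! ≤ o^(o-1) ≤ k^(o-1) on each fiber. Only the fiber over `z` may be empty, so the truncated
o - 1 add up to at most k + 1 - r. -/
lemma prod_factorial_fiber_le {r k : ℕ} (hk : 0 < k) (hrk : r ≤ k) (z : Fin r) (tl : Fin k → Fin r)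
    (h : ∀ w, w ≠ z → ∃ b, tl b = w) :
    ∏ w, ((Finset.univ.filter fun b => tl b = w).card)! ≤ k ^ (k + 1 - r) := by
  set o : Fin r → ℕ := fun w => (Finset.univ.filter fun b => tl b = w).card
  have ho : ∑ w, o w = k := by
    simp only [o]; rw [Finset.sum_card_fiberwise_eq_card_filter]; simp
  have h1 : ∀ w, (o w)! ≤ k ^ (o w - 1) := by
    intro w
    have hle : o w ≤ k := by rw [← ho]; exact Finset.single_le_sum (fun _ _ => Nat.zero_le _) (Finset.mem_univ w)
    rcases Nat.eq_zero_or_pos (o w) with h0 | h0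
    · simp [h0]
    · obtain ⟨q, hq⟩ : ∃ q, o w = q + 1 := ⟨o w - 1, by omega⟩
      rw [hq] at hle ⊢
      rw [Nat.add_sub_cancel, Nat.factorial_succ]
      calc (q + 1) * q ! ≤ (q + 1) ^ q := by
            have : ∀ q : ℕ, (q + 1)! ≤ (q + 1) ^ q := by
              intro q
              induction q with
              | zero => simp
              | succ q ih =>
                rw [Nat.factorial_succ, pow_succ, mul_comm]
                exact Nat.mul_le_mul_right _ (ih.trans (Nat.pow_le_pow_left (by omega) _))
            exact this q
        _ ≤ k ^ q := Nat.pow_le_pow_left hle _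
  refine (Finset.prod_le_prod' fun w _ => h1 w).trans ?_
  rw [Finset.prod_pow_eq_pow_sum]
  refine Nat.pow_le_pow_right hk ?_
  have h2 : ∑ w, (o w - 1 + 1) ≤ ∑ w, (o w + if w = z then 1 else 0) := by
    refine Finset.sum_le_sum fun w _ => ?_
    by_cases hw : w = z
    · simp only [hw, if_true]; omega
    · obtain ⟨b, hb⟩ := h w hw
      have : 0 < o w := Finset.card_pos.2 ⟨b, by simp [hb]⟩
      simp only [hw, if_false]; omega
  rw [Finset.sum_add_distrib, Finset.sum_add_distrib, ho] at h2
  simp at h2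
  omega

-- One factor of the squared factorials is bounded uniformly, the other is summed exactly.
open Classical in
lemma sum_tails_le {r k : ℕ} (hk : 0 < k) (hrk : r ≤ k) (z : Fin r) :
    ∑ tl : Fin k → Fin r, (if ∀ w, w ≠ z → ∃ b, tl b = w then
      ∏ w, (((Finset.univ.filter fun b => tl b = w).card)! : ℝ) ^ 2 else 0) ≤
      (k : ℝ) ^ (k + 1 - r) * (2 * k : ℝ) ^ k := by
  have h1 : ∑ tl : Fin k → Fin r, (if ∀ w, w ≠ z → ∃ b, tl b = w then
      ∏ w, (((Finset.univ.filter fun b => tl b = w).card)! : ℝ) ^ 2 else 0) ≤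
      ∑ tl : Fin k → Fin r, (k : ℝ) ^ (k + 1 - r) *
        ∏ w, (((Finset.univ.filter fun b => tl b = w).card)! : ℝ) := by
    refine Finset.sum_le_sum fun tl _ => ?_
    split_ifs with h
    · rw [Finset.prod_pow, sq]
      refine mul_le_mul_of_nonneg_right ?_ (by positivity)
      exact_mod_cast prod_factorial_fiber_le hk hrk z tl h
    · positivity
  refine h1.trans ?_
  rw [← Finset.mul_sum]
  refine mul_le_mul_of_nonneg_left ?_ (by positivity)
  have h2 : ∑ tl : Fin k → Fin r, ∏ w, (((Finset.univ.filter fun b => tl b = w).card)! : ℝ) =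
      (r.ascFactorial k : ℝ) := by
    rw [← sum_prod_factorial_fiber]; push_cast; rfl
  rw [h2]
  have h3 : r.ascFactorial k ≤ (2 * k) ^ k := by
    have hr : 0 < r := z.pos
    obtain ⟨q, rfl⟩ : ∃ q, r = q + 1 := ⟨r - 1, by omega⟩
    exact (Nat.ascFactorial_le_pow_add q k).trans (Nat.pow_le_pow_left (by omega) _)
  exact_mod_cast h3

end Counting

/-! ### The total weight of the flows with given numbers of heavy vertices and root edges -/

section TotalWeight

open scoped Nat

/-- The bound on the absolute moments of a centered normalized variable with the sub-exponential
moment bound with constant `K`. -/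
noncomputable def momentBound (K : ℝ) (m : ℕ) : ℝ :=
  if m = 0 then 1 else if m = 1 then 0 else if m = 2 then 1 else (K * m) ^ m

lemma momentBound_zero (K : ℝ) : momentBound K 0 = 1 := by simp [momentBound]

lemma momentBound_nonneg {K : ℝ} (hK : 0 ≤ K) (m : ℕ) : 0 ≤ momentBound K m := by
  unfold momentBound
  split_ifs <;> positivity

lemma sq_le_nine_pow (j : ℕ) : (j + 3) ^ 2 ≤ 9 ^ (j + 1) := by
  induction j with
  | zero => norm_num
  | succ j ih =>
    calc (j + 1 + 3) ^ 2 ≤ (j + 3) ^ 2 * 9 := by ring_nf; nlinarith [sq_nonneg j]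
      _ ≤ 9 ^ (j + 1) * 9 := Nat.mul_le_mul_right 9 ih

/-- With m = j + 3, the two surplus factors (Km)² are absorbed into m - 2 factors through m² ≤
9^(m-2). -/
lemma moment_le_pow {K : ℝ} (hK : 1 ≤ K) {j p : ℕ} (hm : j + 3 ≤ 2 * p) {s : ℝ}
    (hs : 36 * K ^ 3 * p ≤ s) : (K * (j + 3 : ℕ)) ^ (j + 3) ≤ s ^ (j + 1) / 2 := by
  have h9 : (((j + 3 : ℕ) : ℝ)) ^ 2 ≤ 9 ^ (j + 1) := by exact_mod_cast sq_le_nine_pow j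
  have hm' : ((j + 3 : ℕ) : ℝ) ≤ 2 * p := by exact_mod_cast hm
  have hK2 : K ^ 2 ≤ (K ^ 2) ^ (j + 1) := le_self_pow₀ (one_le_pow₀ hK) (by omega)
  have hK0 : 0 ≤ K := by linarith
  calc (K * (j + 3 : ℕ)) ^ (j + 3) = (K * (j + 3 : ℕ)) ^ (j + 1) * (K ^ 2 * ((j + 3 : ℕ) : ℝ) ^ 2) := by
        rw [← mul_pow, ← pow_add]
    _ ≤ (K * (2 * p)) ^ (j + 1) * ((K ^ 2) ^ (j + 1) * 9 ^ (j + 1)) := by gcongr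
    _ = (18 * K ^ 3 * p) ^ (j + 1) := by rw [← mul_pow, ← mul_pow]; congr 1; ring
    _ ≤ (s / 2) ^ (j + 1) := by gcongr; linarith
    _ = s ^ (j + 1) * (1 / 2) ^ (j + 1) := by rw [← mul_pow]; congr 1; ring
    _ ≤ s ^ (j + 1) * (1 / 2) := by
        have : 0 ≤ s := le_trans (by positivity) hs
        gcongr
        exact pow_le_of_le_one (by norm_num) (by norm_num) (by omega)
    _ = _ := by ring

/-- For m ≥ 3 one of the l + 1 moments is reduced to K^m by the division by m^m; the other `l` are
controlled by `moment_le_pow`, whose factor 1/2 gives the decay in `l`. For m = 2 the moment is 1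
and nothing decays. -/
lemma path_weight_le {K : ℝ} (hK : 1 ≤ K) {n p m l : ℕ} (hn : 0 < n) (hm2 : 2 ≤ m)
    (hm : m ≤ 2 * p) (hs : 36 * K ^ 3 * p ≤ √(n : ℝ)) :
    (n : ℝ) ^ l * (momentBound K m ^ (l + 1) / (m : ℝ) ^ m) ≤
      √(n : ℝ) ^ (m * (l + 1)) * ((n : ℝ)⁻¹ * (K ^ m * (√(n : ℝ))⁻¹ ^ (m - 2) *
        (if m = 2 then 1 else (1 / 2) ^ l))) := by
  set s := √(n : ℝ)
  have hs0 : 0 < s := by positivity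
  have hns : (n : ℝ) = s ^ 2 := (Real.sq_sqrt (by positivity)).symm
  rw [hns]
  obtain ⟨j, rfl⟩ : ∃ j, m = j + 2 := ⟨m - 2, by omega⟩
  rcases Nat.eq_zero_or_pos j with rfl | hj
  · have : momentBound K 2 = 1 := by simp [momentBound]
    simp only [zero_add, this, one_pow, if_true, Nat.sub_self, pow_zero, mul_one]
    have h1 : s ^ (2 * (l + 1)) * ((s ^ 2)⁻¹ * K ^ 2) = (s ^ 2) ^ l * K ^ 2 := by
      rw [mul_add, pow_add, pow_mul]; field_simp
    rw [h1]
    refine mul_le_mul_of_nonneg_left ?_ (by positivity)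
    have : 1 ≤ K ^ 2 := one_le_pow₀ hK
    norm_num; linarith
  · obtain ⟨i, rfl⟩ : ∃ i, j = i + 1 := ⟨j - 1, by omega⟩
    have hmb : momentBound K (i + 3) = (K * (i + 3 : ℕ)) ^ (i + 3) := by simp [momentBound]
    have key := moment_le_pow hK (j := i) hm hs
    have e1 : momentBound K (i + 1 + 2) ^ (l + 1) / ((i + 1 + 2 : ℕ) : ℝ) ^ (i + 1 + 2) =
        ((K * (i + 3 : ℕ)) ^ (i + 3)) ^ l * K ^ (i + 3) := by
      change momentBound K (i + 3) ^ (l + 1) / ((i + 3 : ℕ) : ℝ) ^ (i + 3) = _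
      rw [hmb, pow_succ, mul_pow K _ (i + 3)]
      field_simp
    have e2 : s ^ ((i + 1 + 2) * (l + 1)) * ((s ^ 2)⁻¹ * (K ^ (i + 1 + 2) * s⁻¹ ^ (i + 1 + 2 - 2) *
        (if i + 1 + 2 = 2 then 1 else (1 / 2) ^ l))) =
        (s ^ 2) ^ l * ((s ^ (i + 1) / 2) ^ l * K ^ (i + 3)) := by
      rw [if_neg (by omega), show i + 1 + 2 - 2 = i + 1 by omega,
        show (i + 1 + 2) * (l + 1) = 2 * l + (i + 1) * l + 2 + (i + 1) by ring, pow_add, pow_add,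
        pow_add, pow_mul, pow_mul s (i + 1), div_pow, inv_pow, div_pow, one_pow]
      field_simp
    rw [e1, e2]
    have hK0 : 0 ≤ K := by linarith
    gcongr

variable {V : Type*} [Fintype V] [DecidableEq V]

omit [DecidableEq V] in
lemma sum_flowCode {p k r : ℕ}
    (G : Fin r → (Fin k → Fin (2 * p + 1)) → (Fin k → Fin r) → (Fin k → Fin p) → ℝ) :
    ∑ d : FlowCode V p k r, G d.snk d.mult d.tail d.len =
      (Fintype.card V : ℝ) ^ r * r * r ^ k * ∑ z, ∑ m, ∑ tl, ∑ l,
        (Fintype.card V : ℝ) ^ (∑ b, (l b : ℕ)) * G z m tl l := by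
  have h0 : ∀ (z : Fin r) (m : Fin k → Fin (2 * p + 1)) (tl : Fin k → Fin r),
      ∑ x : (Σ l : Fin k → Fin p, ∀ b, Fin (l b) → V), G z m tl x.1 =
        ∑ l : Fin k → Fin p, (Fintype.card V : ℝ) ^ (∑ b, (l b : ℕ)) * G z m tl l := by
    intro z m tl
    rw [Fintype.sum_sigma]
    refine Finset.sum_congr rfl fun l _ => ?_
    change ∑ _y : (∀ b, Fin (l b) → V), G z m tl l = _
    rw [Finset.sum_const, Finset.card_univ, Fintype.card_pi, nsmul_eq_mul]
    congr 1
    push_cast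
    simp [Finset.prod_pow_eq_pow_sum]
  have h1 : ∑ d : FlowCode V p k r, G d.snk d.mult d.tail d.len =
      ∑ _h : Fin r → V, ∑ _s : Fin r, ∑ z : Fin r, ∑ m, ∑ tl, ∑ _hd : Fin k → Fin r,
        ∑ x : (Σ l : Fin k → Fin p, ∀ b, Fin (l b) → V), G z m tl x.1 := by
    simp only [Fintype.sum_prod_type]
    rfl
  rw [h1]
  simp only [h0, Finset.sum_const, Finset.card_univ, Fintype.card_fun, Fintype.card_fin,
    nsmul_eq_mul, Nat.cast_pow, ← Finset.mul_sum]
  ring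

lemma sum_geometric_shift_le {p : ℕ} (hp : 0 < p) {c x : ℝ} (hc : 0 ≤ c) (hx : 0 ≤ x)
    (hx2 : x ≤ 1 / 2) :
    ∑ m : Fin (2 * p + 1), (if 2 ≤ (m : ℕ) then c * x ^ ((m : ℕ) - 2) else 0) ≤ c * 2 := by
  rw [← Finset.sum_range (fun m => if 2 ≤ m then c * x ^ (m - 2) else 0)]
  obtain ⟨q, rfl⟩ : ∃ q, p = q + 1 := ⟨p - 1, by omega⟩
  rw [show 2 * (q + 1) + 1 = (2 * q + 1) + 1 + 1 by ring, Finset.sum_range_succ',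
    Finset.sum_range_succ']
  simp only [Nat.reduceLeDiff, if_false, zero_add, add_zero, nonpos_iff_eq_zero,
    OfNat.ofNat_ne_zero]
  rw [Finset.sum_congr rfl (g := fun m => c * x ^ m), ← Finset.mul_sum]
  · refine mul_le_mul_of_nonneg_left ?_ hc
    exact (Finset.sum_le_sum fun i _ => pow_le_pow_left₀ hx hx2 i).trans (sum_geometric_two_le _)
  · intro m _
    rw [if_pos trivial]
    congr 2

/-- The weight of a path without its length factor. -/
noncomputable def multWeight (K : ℝ) (n p m : ℕ) : ℝ :=
  K ^ m * (√(n : ℝ))⁻¹ ^ (m - 2) * (2 * p) ^ (m - 2) * Real.exp 1 ^ (2 * m)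

lemma codeWeight_le {K : ℝ} (hK : 1 ≤ K) {n p k r : ℕ} (hn : 0 < n)
    (hs : 36 * K ^ 3 * p ≤ √(n : ℝ)) (z : Fin r) (m : Fin k → Fin (2 * p + 1))
    (tl : Fin k → Fin r) (l : Fin k → Fin p) (h : FlowCode.IsAdmissible z m tl l) :
    (n : ℝ) ^ (∑ b, (l b : ℕ)) * PairFlow.codeWeight (momentBound K) m tl l ≤
      √(n : ℝ) ^ (2 * p) * (n : ℝ)⁻¹ ^ k * (∏ b, multWeight K n p (m b)) *
        (∏ w, (((Finset.univ.filter fun b => tl b = w).card)! : ℝ) ^ 2) *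
        ∏ b, (if (m b : ℕ) = 2 then (1 : ℝ) else (1 / 2) ^ (l b : ℕ)) := by
  have hK0 : 0 ≤ K := by linarith
  have htot : ∑ b, (m b : ℕ) ≤ 2 * p := by
    refine le_trans ?_ h.total.le
    exact Finset.sum_le_sum fun b _ => Nat.le_mul_of_pos_right _ (by omega)
  have h1 : (n : ℝ) ^ (∑ b, (l b : ℕ)) *
      ∏ b, momentBound K (m b) ^ ((l b : ℕ) + 1) / ((m b : ℕ) : ℝ) ^ (m b : ℕ) ≤
      √(n : ℝ) ^ (2 * p) * (n : ℝ)⁻¹ ^ k * ∏ b, (K ^ (m b : ℕ) * (√(n : ℝ))⁻¹ ^ ((m b : ℕ) - 2) *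
        (if (m b : ℕ) = 2 then 1 else (1 / 2) ^ (l b : ℕ))) := by
    have e1 : √(n : ℝ) ^ (2 * p) = ∏ b, √(n : ℝ) ^ ((m b : ℕ) * ((l b : ℕ) + 1)) := by
      rw [Finset.prod_pow_eq_pow_sum, h.total]
    have e2 : (n : ℝ)⁻¹ ^ k = ∏ _b : Fin k, (n : ℝ)⁻¹ := by simp
    rw [← Finset.prod_pow_eq_pow_sum, ← Finset.prod_mul_distrib, e1, e2, mul_assoc,
      ← Finset.prod_mul_distrib, ← Finset.prod_mul_distrib]
    refine Finset.prod_le_prod (fun b _ => ?_) fun b _ => ?_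
    · have := momentBound_nonneg hK0 (m b); positivity
    · exact path_weight_le hK hn (h.two_le b) (by have := (m b).2; omega) hs
  have h2 : ∏ w, ((∑ b with tl b = w, (m b : ℕ) : ℕ) : ℝ) ^ (∑ b with tl b = w, (m b : ℕ)) ≤
      (∏ b, ((2 * p : ℝ) ^ ((m b : ℕ) - 2) * Real.exp 1 ^ (2 * (m b : ℕ)))) *
        ∏ w, (((Finset.univ.filter fun b => tl b = w).card)! : ℝ) ^ 2 := by
    rw [← Finset.prod_fiberwise Finset.univ tl, ← Finset.prod_mul_distrib]
    refine Finset.prod_le_prod (fun w _ => by positivity) fun w _ => ?_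
    have hle : 2 * (Finset.univ.filter fun b => tl b = w).card ≤ ∑ b with tl b = w, (m b : ℕ) := by
      rw [mul_comm, ← smul_eq_mul]
      exact Finset.card_nsmul_le_sum _ _ _ fun b _ => h.two_le b
    have hle2 : ∑ b with tl b = w, (m b : ℕ) ≤ 2 * p :=
      (Finset.sum_le_sum_of_subset (Finset.filter_subset _ _)).trans htot
    refine (nat_pow_self_le _ _ p hle hle2).trans (le_of_eq ?_)
    rw [Finset.prod_mul_distrib, Finset.prod_pow_eq_pow_sum, Finset.prod_pow_eq_pow_sum,
      ← Finset.mul_sum]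
    congr 3
    rw [Finset.sum_tsub_distrib _ fun b _ => h.two_le b, Finset.sum_const, smul_eq_mul]
    congr 1
    exact mul_comm _ _
  have h3 : (∏ b, multWeight K n p (m b)) *
      (∏ b, (if (m b : ℕ) = 2 then (1 : ℝ) else (1 / 2) ^ (l b : ℕ))) =
      (∏ b, ((2 * p : ℝ) ^ ((m b : ℕ) - 2) * Real.exp 1 ^ (2 * (m b : ℕ)))) *
      ∏ b, (K ^ (m b : ℕ) * (√(n : ℝ))⁻¹ ^ ((m b : ℕ) - 2) *
        (if (m b : ℕ) = 2 then 1 else (1 / 2) ^ (l b : ℕ))) := by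
    rw [← Finset.prod_mul_distrib, ← Finset.prod_mul_distrib]
    refine Finset.prod_congr rfl fun b _ => ?_
    rw [multWeight]; ring
  calc _ = (∏ w, ((∑ b with tl b = w, (m b : ℕ) : ℕ) : ℝ) ^ (∑ b with tl b = w, (m b : ℕ))) *
        ((n : ℝ) ^ (∑ b, (l b : ℕ)) *
          ∏ b, momentBound K (m b) ^ ((l b : ℕ) + 1) / ((m b : ℕ) : ℝ) ^ (m b : ℕ)) := by
        rw [PairFlow.codeWeight]; ring
    _ ≤ _ := mul_le_mul h2 h1 (mul_nonneg (by positivity) (Finset.prod_nonneg fun b _ => by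
        have := momentBound_nonneg hK0 (m b); positivity)) (mul_nonneg (by positivity) (by positivity))
    _ = √(n : ℝ) ^ (2 * p) * (n : ℝ)⁻¹ ^ k *
        (∏ w, (((Finset.univ.filter fun b => tl b = w).card)! : ℝ) ^ 2) *
        ((∏ b, ((2 * p : ℝ) ^ ((m b : ℕ) - 2) * Real.exp 1 ^ (2 * (m b : ℕ)))) *
          ∏ b, (K ^ (m b : ℕ) * (√(n : ℝ))⁻¹ ^ ((m b : ℕ) - 2) *
            (if (m b : ℕ) = 2 then 1 else (1 / 2) ^ (l b : ℕ)))) := by ring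
    _ = _ := by rw [← h3]; ring

lemma multWeight_nonneg {K : ℝ} (hK : 0 ≤ K) (n p m : ℕ) : 0 ≤ multWeight K n p m := by
  unfold multWeight; positivity

open Classical in
lemma sum_tail_len_le {K : ℝ} (hK : 1 ≤ K) {n p k r : ℕ} (hn : 0 < n) (hk : 0 < k) (hkp : k ≤ p)
    (hrk : r ≤ k) (hs : 36 * K ^ 3 * p ≤ √(n : ℝ)) (z : Fin r) (m : Fin k → Fin (2 * p + 1)) :
    ∑ tl : Fin k → Fin r, ∑ l : Fin k → Fin p, (n : ℝ) ^ (∑ b, (l b : ℕ)) *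
      (if FlowCode.IsAdmissible z m tl l then PairFlow.codeWeight (momentBound K) m tl l else 0) ≤
      √(n : ℝ) ^ (2 * p) * (n : ℝ)⁻¹ ^ k *
        (∏ b, if 2 ≤ (m b : ℕ) then multWeight K n p (m b) else 0) *
        ((k : ℝ) ^ (k + 1 - r) * (2 * k : ℝ) ^ k) *
        (2 ^ k * (Real.exp 1 ^ k * (p / k : ℝ) ^ (2 * (k + 1 - r)))) := by
  have hK0 : 0 ≤ K := by linarith
  have hk0 : (0 : ℝ) < k := by exact_mod_cast hk
  by_cases hm : (∀ b, 2 ≤ (m b : ℕ)) ∧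
      (Finset.univ.filter fun b => (m b : ℕ) = 2).card + 2 * r ≤ 2 * k + 3
  swap
  · rw [Finset.sum_eq_zero]
    · refine mul_nonneg (mul_nonneg (mul_nonneg (by positivity) (Finset.prod_nonneg fun b _ => ?_))
        (by positivity)) (by positivity)
      split_ifs
      · exact multWeight_nonneg hK0 _ _ _
      · exact le_rfl
    · intro tl _
      refine Finset.sum_eq_zero fun l _ => ?_
      rw [if_neg fun h => hm ⟨h.two_le, h.double⟩, mul_zero]
  set E := (Finset.univ.filter fun b => (m b : ℕ) = 2).card
  have hprod : ∏ b, (if 2 ≤ (m b : ℕ) then multWeight K n p (m b) else 0) =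
      ∏ b, multWeight K n p (m b) := Finset.prod_congr rfl fun b _ => if_pos (hm.1 b)
  rw [hprod]
  set c := √(n : ℝ) ^ (2 * p) * (n : ℝ)⁻¹ ^ k * ∏ b, multWeight K n p (m b)
  have hc : 0 ≤ c := mul_nonneg (by positivity)
    (Finset.prod_nonneg fun b _ => multWeight_nonneg hK0 _ _ _)
  set A : (Fin k → Fin r) → ℝ := fun tl => if ∀ w, w ≠ z → ∃ b, tl b = w then
      ∏ w, (((Finset.univ.filter fun b => tl b = w).card)! : ℝ) ^ 2 else 0
  set B : (Fin k → Fin p) → ℝ := fun l => if ∑ b, (m b : ℕ) * ((l b : ℕ) + 1) = 2 * p then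
        ∏ b, (if (m b : ℕ) = 2 then (1 : ℝ) else (1 / 2) ^ (l b : ℕ)) else 0
  have hA0 : ∀ tl, 0 ≤ A tl := by
    intro tl; simp only [A]; split_ifs <;> positivity
  have hB0 : ∀ l, 0 ≤ B l := by
    intro l; simp only [B]
    split_ifs
    · exact Finset.prod_nonneg fun b _ => by split_ifs <;> positivity
    · exact le_rfl
  have hterm : ∀ tl l, (n : ℝ) ^ (∑ b, (l b : ℕ)) *
      (if FlowCode.IsAdmissible z m tl l then PairFlow.codeWeight (momentBound K) m tl l else 0) ≤
        c * (A tl * B l) := by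
    intro tl l
    by_cases h : FlowCode.IsAdmissible z m tl l
    · rw [if_pos h]
      refine (codeWeight_le hK hn hs z m tl l h).trans (le_of_eq ?_)
      simp only [A, B]
      rw [if_pos h.tail_surj, if_pos h.total]
      ring
    · rw [if_neg h, mul_zero]
      exact mul_nonneg hc (mul_nonneg (hA0 _) (hB0 _))
  have hA : ∑ tl, A tl ≤ (k : ℝ) ^ (k + 1 - r) * (2 * k : ℝ) ^ k := sum_tails_le hk hrk z
  have hB : ∑ l, B l ≤ 2 ^ k * (Real.exp 1 ^ k * (p / k : ℝ) ^ (2 * (k + 1 - r))) := by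
    refine (sum_lengths_le fun b => (m b : ℕ)).trans ?_
    refine mul_le_mul_of_nonneg_left ?_ (by positivity)
    -- The base is `k`, not `E`: since p/k ≥ 1, the exponent E - 1 can then be raised to 2(k + 1 -
    -- r).
    have h1 := inv_factorial_le_exp_mul_inv_pow hk0 (E - 1)
    have h2 : (1 : ℝ) ≤ p / k := by rw [le_div_iff₀ hk0, one_mul]; exact_mod_cast hkp
    have h3 : Real.exp k = Real.exp 1 ^ k := by rw [← Real.exp_nat_mul]; simp
    calc (p : ℝ) ^ (E - 1) / ((E - 1)! : ℝ) ≤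
          (p : ℝ) ^ (E - 1) * (Real.exp k * ((k : ℝ) ^ (E - 1))⁻¹) := by
            rw [div_eq_mul_inv]; gcongr
      _ = Real.exp 1 ^ k * (p / k : ℝ) ^ (E - 1) := by rw [h3, div_pow]; ring
      _ ≤ _ := by
          have := hm.2
          exact mul_le_mul_of_nonneg_left (pow_le_pow_right₀ h2 (by omega)) (by positivity)
  calc _ ≤ ∑ tl, ∑ l, c * (A tl * B l) :=
        Finset.sum_le_sum fun tl _ => Finset.sum_le_sum fun l _ => hterm tl l
    _ = c * ((∑ tl, A tl) * ∑ l, B l) := by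
        rw [Finset.sum_mul_sum]; simp only [Finset.mul_sum]
    _ ≤ c * (((k : ℝ) ^ (k + 1 - r) * (2 * k : ℝ) ^ k) *
          (2 ^ k * (Real.exp 1 ^ k * (p / k : ℝ) ^ (2 * (k + 1 - r))))) := by
        refine mul_le_mul_of_nonneg_left ?_ hc
        exact mul_le_mul hA hB (Finset.sum_nonneg fun l _ => hB0 l) (by positivity)
    _ = _ := by ring

lemma sum_mult_le {K : ℝ} (hK : 1 ≤ K) {n p k : ℕ} (hn : 0 < n) (hp : 0 < p)
    (hs : 64 * K ^ 3 * p ≤ √(n : ℝ)) :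
    ∑ m : Fin k → Fin (2 * p + 1), ∏ b, (if 2 ≤ (m b : ℕ) then multWeight K n p (m b) else 0) ≤
      (2 * K ^ 2 * Real.exp 1 ^ 4) ^ k := by
  have hK0 : 0 ≤ K := by linarith
  rw [← Fintype.prod_sum (fun _ (j : Fin (2 * p + 1)) =>
    if 2 ≤ (j : ℕ) then multWeight K n p j else 0)]
  rw [Finset.prod_const, Finset.card_univ, Fintype.card_fin]
  refine pow_le_pow_left₀ (Finset.sum_nonneg fun j _ => ?_) ?_ k
  · split_ifs
    · exact multWeight_nonneg hK0 _ _ _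
    · exact le_rfl
  -- The ratio between the weights of consecutive multiplicities; m = 2 is the leading term.
  set x : ℝ := K * Real.exp 1 ^ 2 * (2 * p) / √(n : ℝ) with hx
  have hx2 : x ≤ 1 / 2 := by
    rw [hx, div_le_iff₀ (by positivity)]
    have he : Real.exp 1 ^ 2 ≤ 8 := by
      have := Real.exp_one_lt_d9
      have := Real.exp_pos 1
      nlinarith
    have hK3 : K ≤ K ^ 3 := le_self_pow₀ hK (by norm_num)
    have : K * Real.exp 1 ^ 2 * (2 * p) ≤ K ^ 3 * 8 * (2 * p) := by gcongr
    nlinarith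
  calc _ = ∑ m : Fin (2 * p + 1), (if 2 ≤ (m : ℕ) then
        (K ^ 2 * Real.exp 1 ^ 4) * x ^ ((m : ℕ) - 2) else 0) := by
        refine Finset.sum_congr rfl fun m _ => ?_
        split_ifs with h
        · obtain ⟨j, hj⟩ : ∃ j, (m : ℕ) = j + 2 := ⟨m - 2, by omega⟩
          rw [hj, multWeight, hx, Nat.add_sub_cancel]
          rw [show 2 * (j + 2) = 4 + 2 * j by ring, pow_add, pow_add (Real.exp 1), pow_mul,
            div_pow, mul_pow, mul_pow, inv_pow]
          ring
        · rfl
    _ ≤ (K ^ 2 * Real.exp 1 ^ 4) * 2 :=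
        sum_geometric_shift_le hp (by positivity) (by positivity) hx2
    _ = _ := by ring

/-- The total weight of a family of flows on `n` vertices with `r` heavy vertices and `k` root
edges. -/
lemma PairFlow.sum_weight_le_pow {K : ℝ} (hK : 1 ≤ K) {p k r : ℕ} (hn : 0 < Fintype.card V)
    (hk : 0 < k) (hkp : k ≤ p) (hrk : r ≤ k)
    (hs : 64 * K ^ 3 * p ≤ √(Fintype.card V : ℝ)) (S : Finset (PairFlow V p))
    (hSr : ∀ f ∈ S, f.heavy.card = r) (hSk : ∀ f ∈ S, f.root.card = k) :
    ∑ f ∈ S, f.weight (momentBound K) ≤ (Fintype.card V : ℝ) ^ (p + 1) *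
      ((p : ℝ) ^ 2 / Fintype.card V) ^ (k + 1 - r) * (32 * K ^ 2 * Real.exp 1 ^ 7) ^ k := by
  classical
  have hK0 : 0 ≤ K := by linarith
  have hs' : 36 * K ^ 3 * p ≤ √(Fintype.card V : ℝ) := by
    refine le_trans ?_ hs
    gcongr
    norm_num
  have h1 := PairFlow.sum_weight_le (momentBound K) (momentBound_zero K) (momentBound_nonneg hK0) S
    hSr hSk
  rw [sum_flowCode (V := V) fun z m tl l => if FlowCode.IsAdmissible z m tl l then
    PairFlow.codeWeight (momentBound K) m tl l else 0] at h1
  set n := Fintype.card V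
  have hn0 : (0 : ℝ) < n := by exact_mod_cast hn
  have hk0 : (0 : ℝ) < k := by exact_mod_cast hk
  set e := k + 1 - r with he
  set D : ℝ := √(n : ℝ) ^ (2 * p) * (n : ℝ)⁻¹ ^ k * ((k : ℝ) ^ e * (2 * k : ℝ) ^ k) *
        (2 ^ k * (Real.exp 1 ^ k * (p / k : ℝ) ^ (2 * e)))
  have h2 : ∑ z : Fin r, ∑ m : Fin k → Fin (2 * p + 1), ∑ tl : Fin k → Fin r, ∑ l : Fin k → Fin p,
      (n : ℝ) ^ (∑ b, (l b : ℕ)) * (if FlowCode.IsAdmissible z m tl l then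
        PairFlow.codeWeight (momentBound K) m tl l else 0) ≤
      r * (D * (2 * K ^ 2 * Real.exp 1 ^ 4) ^ k) := by
    calc _ ≤ ∑ z : Fin r, ∑ m : Fin k → Fin (2 * p + 1),
          D * ∏ b, (if 2 ≤ (m b : ℕ) then multWeight K n p (m b) else 0) := by
          refine Finset.sum_le_sum fun z _ => Finset.sum_le_sum fun m _ => ?_
          refine (sum_tail_len_le hK hn hk hkp hrk hs' z m).trans (le_of_eq ?_)
          simp only [D, ← he]; ring
      _ ≤ ∑ z : Fin r, D * (2 * K ^ 2 * Real.exp 1 ^ 4) ^ k := by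
          refine Finset.sum_le_sum fun z _ => ?_
          rw [← Finset.mul_sum]
          exact mul_le_mul_of_nonneg_left (sum_mult_le hK hn (by omega) hs) (by positivity)
      _ = _ := by simp
  have h3 := h1.trans (mul_le_mul_of_nonneg_left h2 (by positivity))
  rw [mul_comm, ← le_div_iff₀ (by positivity)] at h3
  refine h3.trans ?_
  have hfr : ((r ! : ℝ))⁻¹ ≤ Real.exp 1 ^ k * ((k : ℝ) ^ r)⁻¹ := by
    have := inv_factorial_le_exp_mul_inv_pow hk0 r
    rwa [show Real.exp k = Real.exp 1 ^ k by rw [← Real.exp_nat_mul]; simp] at this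
  have hfk : (r : ℝ) ^ k * ((k ! : ℝ))⁻¹ ≤ Real.exp 1 ^ k := by
    have h := Real.pow_div_factorial_le_exp (k : ℝ) hk0.le k
    rw [show Real.exp k = Real.exp 1 ^ k by rw [← Real.exp_nat_mul]; simp] at h
    refine le_trans ?_ h
    rw [div_eq_mul_inv]
    gcongr
  have hr2 : (r : ℝ) * r ≤ 4 ^ k := by
    have h : r ≤ 2 ^ k := hrk.trans (Nat.lt_two_pow_self).le
    have h' : (r : ℝ) ≤ 2 ^ k := by exact_mod_cast h
    calc (r : ℝ) * r ≤ 2 ^ k * 2 ^ k := by gcongr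
      _ = 4 ^ k := by rw [← mul_pow]; norm_num
  -- The powers of `k` balance: e + k comes from the tails, -r from 1/r!, and -2e from the lengths,
  -- which add up to -1.
  have hkk : (k : ℝ) ^ e * k ^ k * (((k : ℝ) ^ r)⁻¹ * ((k : ℝ) ^ (2 * e))⁻¹) ≤ 1 := by
    rw [← mul_inv, ← pow_add, ← pow_add, ← div_eq_mul_inv, div_le_one (by positivity)]
    exact pow_le_pow_right₀ (by exact_mod_cast hk) (by omega)
  have hsn : √(n : ℝ) ^ (2 * p) = (n : ℝ) ^ p := by
    rw [pow_mul, Real.sq_sqrt hn0.le]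
  have hnn : (n : ℝ) ^ r * (n : ℝ)⁻¹ ^ k = n * (n : ℝ)⁻¹ ^ e := by
    rw [inv_pow, inv_pow, ← div_eq_mul_inv, ← div_eq_mul_inv, div_eq_div_iff (by positivity)
      (by positivity), ← pow_add, ← pow_succ']
    congr 1; omega
  calc (n : ℝ) ^ r * r * r ^ k * (r * (D * (2 * K ^ 2 * Real.exp 1 ^ 4) ^ k)) / (r ! * k !) =
        ((n : ℝ) ^ r * (n : ℝ)⁻¹ ^ k) * (n : ℝ) ^ p * ((r : ℝ) * r) * (r ^ k * ((k ! : ℝ))⁻¹) *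
          ((r ! : ℝ))⁻¹ * ((k : ℝ) ^ e * k ^ k * (((k : ℝ) ^ (2 * e))⁻¹)) * (p : ℝ) ^ (2 * e) *
          (8 * K ^ 2 * Real.exp 1 ^ 5) ^ k := by
        have hC : (8 * K ^ 2 * Real.exp 1 ^ 5) ^ k =
            2 ^ k * 2 ^ k * Real.exp 1 ^ k * (2 * K ^ 2 * Real.exp 1 ^ 4) ^ k := by
          rw [← mul_pow, ← mul_pow, ← mul_pow]; congr 1; ring
        rw [hC]
        simp only [D, hsn, mul_pow, div_eq_mul_inv, mul_inv]
        ring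
    _ ≤ (n * (n : ℝ)⁻¹ ^ e) * (n : ℝ) ^ p * 4 ^ k * Real.exp 1 ^ k *
          (Real.exp 1 ^ k * ((k : ℝ) ^ r)⁻¹) * ((k : ℝ) ^ e * k ^ k * (((k : ℝ) ^ (2 * e))⁻¹)) *
          (p : ℝ) ^ (2 * e) * (8 * K ^ 2 * Real.exp 1 ^ 5) ^ k := by
        rw [hnn]; gcongr
    _ = ((k : ℝ) ^ e * k ^ k * (((k : ℝ) ^ r)⁻¹ * ((k : ℝ) ^ (2 * e))⁻¹)) *
          ((n : ℝ) ^ (p + 1) * ((p : ℝ) ^ 2 / n) ^ e * (32 * K ^ 2 * Real.exp 1 ^ 7) ^ k) := by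
        have hC : (32 * K ^ 2 * Real.exp 1 ^ 7) ^ k =
            4 ^ k * Real.exp 1 ^ k * Real.exp 1 ^ k * (8 * K ^ 2 * Real.exp 1 ^ 5) ^ k := by
          rw [← mul_pow, ← mul_pow, ← mul_pow]; congr 1; ring
        rw [hC, div_pow, ← pow_mul, pow_succ, inv_pow, div_eq_mul_inv]
        ring
    _ ≤ 1 * ((n : ℝ) ^ (p + 1) * ((p : ℝ) ^ 2 / n) ^ e * (32 * K ^ 2 * Real.exp 1 ^ 7) ^ k) :=
        mul_le_mul_of_nonneg_right hkk (by positivity)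
    _ = _ := one_mul _

end TotalWeight

/-! ### Walks and their edge multiplicities -/

section Walks

variable {V : Type*} [Fintype V] [DecidableEq V] {p : ℕ}

/-- The number of traversals of the edge `(i, j)` by the walk `u`. -/
def edgeCount (u : Fin (p + 1) → V) (i j : V) : ℕ :=
  (Finset.univ.filter fun t : Fin p => (u t.castSucc, u t.succ) = (i, j)).card

/-- The number of traversals of the edge `(i, j)` by the walks `u` and `v`. -/
def pairCount (u v : Fin (p + 1) → V) (i j : V) : ℕ := edgeCount u i j + edgeCount v i j

lemma prod_edges_eq {R : Type*} [CommMonoid R] (Q : V → V → R) (u : Fin (p + 1) → V) :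
    ∏ t : Fin p, Q (u t.castSucc) (u t.succ) = ∏ i, ∏ j, Q i j ^ edgeCount u i j := by
  rw [← Fintype.prod_prod_type' (fun i j => Q i j ^ edgeCount u i j)]
  rw [← Finset.prod_fiberwise' Finset.univ (fun t : Fin p => (u t.castSucc, u t.succ))
    (fun e => Q e.1 e.2)]
  refine Finset.prod_congr rfl fun e _ => ?_
  rw [Finset.prod_const]
  rfl

lemma sum_edges_eq (f : V → V → ℕ) (u : Fin (p + 1) → V) :
    ∑ i, ∑ j, edgeCount u i j * f i j = ∑ t : Fin p, f (u t.castSucc) (u t.succ) := by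
  have h := prod_edges_eq (fun i j => Multiplicative.ofAdd (f i j)) u
  apply Multiplicative.ofAdd.injective
  rw [ofAdd_sum, ofAdd_sum, h]
  refine Finset.prod_congr rfl fun i _ => ?_
  rw [ofAdd_sum]
  refine Finset.prod_congr rfl fun j _ => ?_
  rw [← ofAdd_nsmul, smul_eq_mul]

lemma sum_edgeCount_out (u : Fin (p + 1) → V) (c : V) :
    ∑ j, edgeCount u c j = ∑ t : Fin p, if u t.castSucc = c then 1 else 0 := by
  rw [← sum_edges_eq (fun i _ => if i = c then 1 else 0) u]
  simp

lemma sum_edgeCount_in (u : Fin (p + 1) → V) (c : V) :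
    ∑ i, edgeCount u i c = ∑ t : Fin p, if u t.succ = c then 1 else 0 := by
  rw [← sum_edges_eq (fun _ j => if j = c then 1 else 0) u]
  simp

lemma edgeCount_balance (u : Fin (p + 1) → V) (c : V) :
    (∑ j, edgeCount u c j) + (if c = u (Fin.last p) then 1 else 0) =
      (∑ j, edgeCount u j c) + (if c = u 0 then 1 else 0) := by
  rw [sum_edgeCount_out, sum_edgeCount_in]
  simp only [eq_comm (a := c)]
  rw [← Fin.sum_univ_castSucc (fun t : Fin (p + 1) => if u t = c then 1 else 0),
    Fin.sum_univ_succ, add_comm]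

lemma edgeCount_total (u : Fin (p + 1) → V) : ∑ i, ∑ j, edgeCount u i j = p := by
  have := sum_edges_eq (fun _ _ => 1) u
  simpa using this

omit [Fintype V] in
lemma edgeCount_pos (u : Fin (p + 1) → V) (t : Fin p) :
    0 < edgeCount u (u t.castSucc) (u t.succ) :=
  Finset.card_pos.2 ⟨t, by simp⟩

omit [Fintype V] in
lemma exists_edge_of_edgeCount {u : Fin (p + 1) → V} {i j : V} (h : edgeCount u i j ≠ 0) :
    ∃ t : Fin p, u t.castSucc = i ∧ u t.succ = j := by
  obtain ⟨t, ht⟩ := Finset.card_pos.1 (Nat.pos_of_ne_zero h)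
  exact ⟨t, by simpa using ht⟩

omit [Fintype V] [DecidableEq V] in
/-- The extension of a walk to all times, constant after the last step. -/
def walkAt (u : Fin (p + 1) → V) (τ : ℕ) : V := u ⟨min τ p, by omega⟩

omit [Fintype V] [DecidableEq V] in
lemma walkAt_of_le (u : Fin (p + 1) → V) {τ : ℕ} (h : τ ≤ p) :
    walkAt u τ = u ⟨τ, by omega⟩ := by
  simp only [walkAt, min_eq_left h]

omit [Fintype V] in
lemma edgeCount_walkAt_pos (u : Fin (p + 1) → V) {τ : ℕ} (h : τ < p) :
    0 < edgeCount u (walkAt u τ) (walkAt u (τ + 1)) := by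
  rw [walkAt_of_le u h.le, walkAt_of_le u h]
  exact edgeCount_pos u ⟨τ, h⟩

omit [Fintype V] in
lemma exists_walk_through {u : Fin (p + 1) → V} {M : V → V → ℕ}
    (hM : ∀ i j, edgeCount u i j ≤ M i j) {i j : V} (h : edgeCount u i j ≠ 0) :
    ∃ (T : ℕ) (x : ℕ → V) (t : ℕ), t < T ∧ x 0 = u 0 ∧ x T = u (Fin.last p) ∧
      (∀ τ < T, M (x τ) (x (τ + 1)) ≠ 0) ∧ x t = i ∧ x (t + 1) = j := by
  obtain ⟨t, h1, h2⟩ := exists_edge_of_edgeCount h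
  refine ⟨p, walkAt u, t, t.2, ?_, ?_, fun τ hτ => ?_, ?_, ?_⟩
  · rw [walkAt_of_le u (Nat.zero_le _)]; rfl
  · rw [walkAt_of_le u le_rfl]; rfl
  · have := edgeCount_walkAt_pos u hτ
    have := hM (walkAt u τ) (walkAt u (τ + 1))
    omega
  · rw [walkAt_of_le u t.2.le]; exact h1
  · rw [walkAt_of_le u t.2]; exact h2

lemma isPairFlow_pairCount (hp : 0 < p) {u v : Fin (p + 1) → V} (h0 : u 0 = v 0)
    (h1 : u (Fin.last p) = v (Fin.last p)) (hne : ∀ i j, pairCount u v i j ≠ 1) :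
    IsPairFlow p (pairCount u v) (u 0) (u (Fin.last p)) where
  ne_one := hne
  balance c := by
    have hu := edgeCount_balance u c
    have hv := edgeCount_balance v c
    rw [← h0, ← h1] at hv
    simp only [pairCount, Finset.sum_add_distrib]
    split_ifs at * <;> omega
  total := by
    have hu := edgeCount_total u
    have hv := edgeCount_total v
    simp only [pairCount, Finset.sum_add_distrib]
    omega
  pos := hp
  walk i j hij := by
    by_cases hu : edgeCount u i j = 0
    · have hv : edgeCount v i j ≠ 0 := by
        simp only [pairCount] at hij; omega
      rw [h0, h1]
      exact exists_walk_through (fun i j => by simp [pairCount]) hv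
    · exact exists_walk_through (fun i j => by simp [pairCount]) hu

/-- If each vertex has at most one out-neighbour and the common end has none, then two walks with
the same ends are equal and self-avoiding. -/
lemma eq_and_injective_of_card_outNbr_le {u v : Fin (p + 1) → V} (h0 : u 0 = v 0)
    (hz : (outNbr (pairCount u v) (u (Fin.last p))).card = 0)
    (hc : ∀ c, (outNbr (pairCount u v) c).card ≤ 1) : u = v ∧ Function.Injective u := by
  have hdet : ∀ {c i j}, pairCount u v c i ≠ 0 → pairCount u v c j ≠ 0 → i = j := by
    intro c i j hi hj
    exact Finset.card_le_one.1 (hc c) i (by simpa [outNbr] using hi) j (by simpa [outNbr] using hj)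
  have hu : ∀ {τ}, τ < p → pairCount u v (walkAt u τ) (walkAt u (τ + 1)) ≠ 0 := by
    intro τ hτ
    have := edgeCount_walkAt_pos u hτ
    simp only [pairCount]; omega
  have hv : ∀ {τ}, τ < p → pairCount u v (walkAt v τ) (walkAt v (τ + 1)) ≠ 0 := by
    intro τ hτ
    have := edgeCount_walkAt_pos v hτ
    simp only [pairCount]; omega
  have huv : ∀ τ ≤ p, walkAt u τ = walkAt v τ := by
    intro τ
    induction τ with
    | zero => intro _; rw [walkAt_of_le u (Nat.zero_le _), walkAt_of_le v (Nat.zero_le _)]; exact h0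
    | succ τ ih =>
      intro hτ
      have h := hv (Nat.lt_of_succ_le hτ)
      rw [← ih (by omega)] at h
      exact hdet (hu (Nat.lt_of_succ_le hτ)) h
  -- The steps are deterministic, so a repeated vertex would bring the walk to its end already at
  -- time a + (p - b) < p, from where it would have to leave.
  have hper : ∀ a b : ℕ, a < b → b ≤ p → walkAt u a ≠ walkAt u b := by
    intro a b hab hbp heq
    have hall : ∀ i, b + i ≤ p → walkAt u (a + i) = walkAt u (b + i) := by
      intro i
      induction i with
      | zero => intro _; simpa using heq
      | succ i ih =>
        intro hi
        have h2 := hu (τ := b + i) (by omega)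
        rw [← ih (by omega)] at h2
        exact hdet (hu (τ := a + i) (by omega)) h2
    have h1 := hall (p - b) (by omega)
    have h2 := hu (τ := a + (p - b)) (by omega)
    rw [h1, show b + (p - b) = p by omega, walkAt_of_le u le_rfl] at h2
    rw [Finset.card_eq_zero, outNbr, Finset.filter_eq_empty_iff] at hz
    exact hz (Finset.mem_univ (walkAt u (a + (p - b) + 1))) h2
  refine ⟨funext fun t => ?_, fun a b hab => ?_⟩
  · have := huv t (by omega)
    rwa [walkAt_of_le u (by omega), walkAt_of_le v (by omega)] at this
  · have ha := walkAt_of_le u (τ := a) (by omega)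
    have hb := walkAt_of_le u (τ := b) (by omega)
    have hab' : walkAt u a = walkAt u b := by rw [ha, hb]; exact hab
    rcases lt_trichotomy (a : ℕ) b with h | h | h
    · exact absurd hab' (hper a b h (by omega))
    · exact Fin.ext h
    · exact absurd hab'.symm (hper b a h (by omega))

/-- The entries of a power of a matrix are sums over walks. -/
lemma pow_apply_eq_sum_walks {R : Type*} [CommSemiring R] (Q : Matrix V V R) (p : ℕ) (s z : V) :
    (Q ^ p) s z = ∑ u : Fin (p + 1) → V, if u 0 = s ∧ u (Fin.last p) = z then
      ∏ t : Fin p, Q (u t.castSucc) (u t.succ) else 0 := by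
  induction p generalizing s with
  | zero =>
    rw [← (Equiv.funUnique (Fin 1) V).symm.sum_comp]
    simp only [pow_zero, Matrix.one_apply]
    simp [Equiv.funUnique, ite_and, Finset.sum_ite_eq']
  | succ p ih =>
    have hcons : ∀ (c : V) (u : Fin (p + 1) → V),
        ∏ t : Fin (p + 1), Q ((Fin.cons c u : Fin (p + 1 + 1) → V) t.castSucc)
          ((Fin.cons c u : Fin (p + 1 + 1) → V) t.succ) =
          Q c (u 0) * ∏ t : Fin p, Q (u t.castSucc) (u t.succ) := by
      intro c u
      rw [Fin.prod_univ_succ]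
      simp only [Fin.castSucc_zero, Fin.cons_zero, Fin.cons_succ, ← Fin.succ_castSucc]
    rw [pow_succ', Matrix.mul_apply, ← (Fin.consEquiv fun _ : Fin (p + 1 + 1) => V).sum_comp,
      Fintype.sum_prod_type]
    refine Eq.trans ?_ (Finset.sum_eq_single s ?_ ?_).symm
    · simp only [ih, Fin.consEquiv_apply, Fin.cons_zero, ← Fin.succ_last, hcons]
      simp only [Fin.cons_succ, true_and, Finset.mul_sum]
      rw [Finset.sum_comm]
      refine Finset.sum_congr rfl fun u _ => ?_
      rw [Finset.sum_eq_single (u 0)]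
      · simp
      · intro c _ hc; rw [if_neg fun h => hc h.1.symm, mul_zero]
      · simp
    · intro c _ hc
      refine Finset.sum_eq_zero fun u _ => ?_
      simp [hc]
    · simp

lemma sum_walks_le_one {Q : Matrix V V ℝ} (hQ0 : ∀ i j, 0 ≤ Q i j) (hQ : ∀ i, ∑ j, Q i j ≤ 1)
    (p : ℕ) (s : V) : ∑ u : Fin (p + 1) → V, (if u 0 = s then
      ∏ t : Fin p, Q (u t.castSucc) (u t.succ) else 0) ≤ 1 := by
  have h1 : ∑ u : Fin (p + 1) → V, (if u 0 = s then
      ∏ t : Fin p, Q (u t.castSucc) (u t.succ) else 0) = ∑ z, (Q ^ p) s z := by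
    simp only [pow_apply_eq_sum_walks]
    rw [Finset.sum_comm]
    refine Finset.sum_congr rfl fun u _ => ?_
    simp [ite_and]
  have h2 : ∀ s, ∑ z, (Q ^ p) s z ≤ 1 := by
    clear h1
    induction p with
    | zero => intro s; simp [Matrix.one_apply]
    | succ p ih =>
      intro s
      simp only [pow_succ', Matrix.mul_apply]
      rw [Finset.sum_comm]
      simp only [← Finset.mul_sum]
      refine (Finset.sum_le_sum fun i _ => mul_le_of_le_one_right (hQ0 s i) (ih i)).trans (hQ s)
  exact h1.trans_le (h2 s)

/-! ### Counting pairs of walks with given edge multiplicities -/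

omit [DecidableEq V] in
lemma prod_div_outFlow_pow (M : V → V → ℕ) :
    ∏ i, ∏ j, ((M i j : ℝ) / outFlow M i) ^ M i j =
      (∏ i, ∏ j, (M i j : ℝ) ^ M i j) / ∏ c, (outFlow M c : ℝ) ^ outFlow M c := by
  simp only [div_pow, Finset.prod_div_distrib, Finset.prod_pow_eq_pow_sum]
  rfl

/-- The number of pairs of walks with given edge multiplicities and common starting vertex. -/
lemma card_pairs_mul_le (M : V → V → ℕ) (s : V)
    (S : Finset ((Fin (p + 1) → V) × (Fin (p + 1) → V)))
    (hS : ∀ x ∈ S, x.1 0 = s ∧ x.2 0 = s ∧ pairCount x.1 x.2 = M) :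
    (S.card : ℝ) ≤ (∏ c, (outFlow M c : ℝ) ^ outFlow M c) / ∏ i, ∏ j, (M i j : ℝ) ^ M i j := by
  have hpow : ∀ m : ℕ, (0 : ℝ) < (m : ℝ) ^ m := by
    intro m
    rcases Nat.eq_zero_or_pos m with rfl | h <;> positivity
  have hA : (0 : ℝ) < ∏ c, (outFlow M c : ℝ) ^ outFlow M c := Finset.prod_pos fun c _ => hpow _
  have hB : (0 : ℝ) < ∏ i, ∏ j, (M i j : ℝ) ^ M i j :=
    Finset.prod_pos fun i _ => Finset.prod_pos fun j _ => hpow _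
  -- A substochastic transition matrix, with zero rows where nothing leaves. Two independent walks
  -- from `s` realize every pair in `S` with the same probability ∏ Q^M, and these probabilities add
  -- up to at most 1.
  set Q : Matrix V V ℝ := fun i j => (M i j : ℝ) / outFlow M i
  have hQ0 : ∀ i j, 0 ≤ Q i j := fun i j => by positivity
  have hQ1 : ∀ i, ∑ j, Q i j ≤ 1 := by
    intro i
    simp only [Q, ← Finset.sum_div]
    refine div_le_one_of_le₀ ?_ (Nat.cast_nonneg _)
    rw [outFlow]; push_cast; rfl
  set g : (Fin (p + 1) → V) → ℝ := fun u =>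
    if u 0 = s then ∏ t : Fin p, Q (u t.castSucc) (u t.succ) else 0 with hg
  have hg0 : ∀ u, 0 ≤ g u := by
    intro u; simp only [hg]
    split_ifs
    · exact Finset.prod_nonneg fun t _ => hQ0 _ _
    · exact le_rfl
  have hg1 : ∑ u, g u ≤ 1 := sum_walks_le_one hQ0 hQ1 p s
  have h1 : ∑ x ∈ S, g x.1 * g x.2 ≤ 1 := by
    calc ∑ x ∈ S, g x.1 * g x.2 ≤
          ∑ x : (Fin (p + 1) → V) × (Fin (p + 1) → V), g x.1 * g x.2 :=
          Finset.sum_le_sum_of_subset_of_nonneg (Finset.subset_univ _) fun x _ _ =>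
            mul_nonneg (hg0 _) (hg0 _)
      _ = (∑ u, g u) * ∑ v, g v := by rw [Fintype.sum_prod_type, Finset.sum_mul_sum]
      _ ≤ 1 := mul_le_one₀ hg1 (Finset.sum_nonneg fun v _ => hg0 v) hg1
  have h2 : ∀ x ∈ S, g x.1 * g x.2 = (∏ i, ∏ j, (M i j : ℝ) ^ M i j) /
      ∏ c, (outFlow M c : ℝ) ^ outFlow M c := by
    intro x hx
    obtain ⟨a, b, c⟩ := hS x hx
    rw [← prod_div_outFlow_pow, hg]
    simp only [a, b, if_true]
    rw [prod_edges_eq, prod_edges_eq]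
    simp only [← Finset.prod_mul_distrib, ← pow_add]
    simp only [← c]
    rfl
  rw [Finset.sum_congr rfl h2, Finset.sum_const, nsmul_eq_mul] at h1
  rw [le_div_iff₀ hB]
  rw [mul_div_assoc', div_le_one hA] at h1
  exact h1

/-- The pairs of walks with common ends in which no edge is traversed exactly once in total and
which are not two copies of a self-avoiding walk. -/
abbrev TangledPair (V : Type*) [Fintype V] [DecidableEq V] (p : ℕ) : Type _ :=
  {x : (Fin (p + 1) → V) × (Fin (p + 1) → V) // x.1 0 = x.2 0 ∧
    x.1 (Fin.last p) = x.2 (Fin.last p) ∧ (∀ i j, pairCount x.1 x.2 i j ≠ 1) ∧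
    ¬ (x.1 = x.2 ∧ Function.Injective x.1)}

/-- The flow of a tangled pair of walks. -/
def TangledPair.flow (hp : 0 < p) (x : TangledPair V p) : PairFlow V p :=
  ⟨(pairCount x.1.1 x.1.2, x.1.1 0, x.1.1 (Fin.last p)),
    isPairFlow_pairCount hp x.2.1 x.2.2.1 x.2.2.2.1⟩

lemma TangledPair.heavy_card_le (hp : 0 < p) (x : TangledPair V p) :
    (x.flow hp).heavy.card ≤ (x.flow hp).root.card := by
  refine (x.flow hp).2.card_heavy_le ?_
  by_contra h
  push Not at h
  refine x.2.2.2.2 (eq_and_injective_of_card_outNbr_le x.2.1 ?_ h.2)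
  have := h.1
  exact Nat.le_zero.1 this

open Classical in
lemma TangledPair.sum_prod_le [Fintype (TangledPair V p)] (hp : 0 < p) {φ : ℕ → ℝ} (hφ : ∀ m, 0 ≤ φ m) :
    ∑ x : TangledPair V p, ∏ i, ∏ j, φ (pairCount x.1.1 x.1.2 i j) ≤
      ∑ f ∈ Finset.univ.image (TangledPair.flow (V := V) hp), f.weight φ := by
  have h := Finset.sum_comp (s := Finset.univ) (fun f : PairFlow V p => ∏ i, ∏ j, φ (f.1.1 i j))
    (TangledPair.flow (V := V) hp)
  refine h.trans_le (Finset.sum_le_sum fun f _ => ?_)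
  have hc := card_pairs_mul_le f.1.1 f.1.2.1
    ((Finset.univ.filter fun x : TangledPair V p => x.flow hp = f).map
      (Function.Embedding.subtype _)) (by
    intro x hx
    obtain ⟨y, hy, rfl⟩ := Finset.mem_map.1 hx
    have hy' := (Finset.mem_filter.1 hy).2
    subst hy'
    exact ⟨rfl, y.2.1.symm, rfl⟩)
  rw [Finset.card_map] at hc
  rw [nsmul_eq_mul, PairFlow.weight]
  simp only [Finset.prod_div_distrib]
  rw [mul_comm, mul_div_left_comm]
  exact mul_le_mul_of_nonneg_left hc
    (Finset.prod_nonneg fun i _ => Finset.prod_nonneg fun j _ => hφ _)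

lemma IsPairFlow.card_rootEdges_le {M : V → V → ℕ} {s z : V} (h : IsPairFlow p M s z) :
    (rootEdges M s z).card ≤ p := by
  have h1 := h.sum_rootEdges_mult
  have h2 : (rootEdges M s z).card • 2 ≤
      ∑ b ∈ rootEdges M s z, M b.1 b.2 * (pathLen M s z b + 1) :=
    Finset.card_nsmul_le_sum _ _ _ fun b hb =>
      (h.two_le_mult (mem_rootEdges.1 hb).1).trans (Nat.le_mul_of_pos_right _ (by omega))
  rw [h1, smul_eq_mul] at h2
  omega

/-- The geometric sum that bounds the total contribution of the tangled pairs. -/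
lemma sum_excess_le {x C : ℝ} (hx : 0 ≤ x) (hC : 1 ≤ C) (hxC : 2 * C ^ 4 * x ≤ 1 / 2) (p : ℕ) :
    ∑ e ∈ Finset.Icc 1 p, ∑ k ∈ Finset.range (3 * e + 2), x ^ e * C ^ k ≤ 20 * C ^ 4 * x := by
  have hC0 : 0 ≤ C := by linarith
  set y := 2 * C ^ 4 * x with hy
  have hy0 : 0 ≤ y := by positivity
  calc _ ≤ ∑ e ∈ Finset.Icc 1 p, 5 * y ^ e := by
        refine Finset.sum_le_sum fun e he => ?_
        have he1 := (Finset.mem_Icc.1 he).1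
        calc _ ≤ ∑ k ∈ Finset.range (3 * e + 2), x ^ e * C ^ (4 * e) := by
              refine Finset.sum_le_sum fun k hk => ?_
              have := Finset.mem_range.1 hk
              exact mul_le_mul_of_nonneg_left (pow_le_pow_right₀ hC (by omega)) (by positivity)
          _ = (3 * e + 2 : ℕ) * (x ^ e * C ^ (4 * e)) := by simp
          _ ≤ (5 * 2 ^ e) * (x ^ e * C ^ (4 * e)) := by
              have : 3 * e + 2 ≤ 5 * 2 ^ e := by have := Nat.lt_two_pow_self (n := e); omega
              have : ((3 * e + 2 : ℕ) : ℝ) ≤ 5 * 2 ^ e := by exact_mod_cast this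
              gcongr
          _ = 5 * y ^ e := by rw [hy, mul_pow, mul_pow, ← pow_mul]; ring
    _ = 5 * y * ∑ e ∈ Finset.range p, y ^ e := by
        rw [Finset.mul_sum, Finset.range_eq_Ico, ← Finset.Ico_add_one_right_eq_Icc,
          Finset.sum_Ico_add' (fun e => 5 * y ^ e) 0 p 1 |>.symm]
        refine Finset.sum_congr rfl fun e _ => by ring
    _ ≤ 5 * y * 2 := by
        refine mul_le_mul_of_nonneg_left ?_ (by positivity)
        exact (Finset.sum_le_sum fun i _ => pow_le_pow_left₀ hy0 hxC i).trans
          (sum_geometric_two_le _)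
    _ = _ := by rw [hy]; ring

/-- The total contribution of the tangled pairs of walks. -/
theorem TangledPair.sum_prod_momentBound_le [Fintype (TangledPair V p)] {K : ℝ} (hK : 1 ≤ K) (hp : 0 < p)
    (hn : 0 < Fintype.card V) (hs : 64 * K ^ 3 * p ≤ √(Fintype.card V : ℝ))
    (hx : 2 * (32 * K ^ 2 * Real.exp 1 ^ 7) ^ 4 * ((p : ℝ) ^ 2 / Fintype.card V) ≤ 1 / 2) :
    ∑ x : TangledPair V p, ∏ i, ∏ j, momentBound K (pairCount x.1.1 x.1.2 i j) ≤
      20 * (32 * K ^ 2 * Real.exp 1 ^ 7) ^ 4 * (p : ℝ) ^ 2 * (Fintype.card V : ℝ) ^ p := by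
  have hK0 : 0 ≤ K := by linarith
  classical
  refine (TangledPair.sum_prod_le hp (momentBound_nonneg hK0)).trans ?_
  set S := Finset.univ.image (TangledPair.flow (V := V) hp)
  set n := Fintype.card V
  have hn0 : (0 : ℝ) < n := by exact_mod_cast hn
  set C := 32 * K ^ 2 * Real.exp 1 ^ 7 with hCdef
  have hC : 1 ≤ C := by
    have h1 : 1 ≤ K ^ 2 := one_le_pow₀ hK
    have h2 : 1 ≤ Real.exp 1 ^ 7 := one_le_pow₀ (Real.one_le_exp zero_le_one)
    rw [hCdef]; nlinarith
  have hS : ∀ f ∈ S, 0 < f.heavy.card ∧ f.heavy.card ≤ f.root.card ∧ f.root.card ≤ p ∧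
      3 * f.heavy.card ≤ 2 * f.root.card + 4 := by
    intro f hf
    obtain ⟨x, -, rfl⟩ := Finset.mem_image.1 hf
    -- The second bound gives e ≥ 1 for the excess e = k + 1 - r, and the last one gives k ≤ 3e + 1.
    exact ⟨Finset.card_pos.2 ⟨_, IsPairFlow.source_mem⟩, x.heavy_card_le hp,
      (x.flow hp).2.card_rootEdges_le, (x.flow hp).2.three_mul_card_heavy_le⟩
  calc ∑ f ∈ S, f.weight (momentBound K) =
        ∑ e ∈ Finset.Icc 1 p, ∑ f ∈ S with f.root.card + 1 - f.heavy.card = e,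
          f.weight (momentBound K) := by
        refine (Finset.sum_fiberwise_of_maps_to (fun f hf => ?_) _).symm
        have := hS f hf
        rw [Finset.mem_Icc]; omega
    _ = ∑ e ∈ Finset.Icc 1 p, ∑ k ∈ Finset.range (3 * e + 2),
          ∑ f ∈ (S.filter fun f => f.root.card + 1 - f.heavy.card = e) with f.root.card = k,
          f.weight (momentBound K) := by
        refine Finset.sum_congr rfl fun e _ => ?_
        refine (Finset.sum_fiberwise_of_maps_to (fun f hf => ?_) _).symm
        obtain ⟨hf, he⟩ := Finset.mem_filter.1 hf
        have := hS f hf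
        rw [Finset.mem_range]; omega
    _ ≤ ∑ e ∈ Finset.Icc 1 p, ∑ k ∈ Finset.range (3 * e + 2),
          (n : ℝ) ^ (p + 1) * (((p : ℝ) ^ 2 / n) ^ e * C ^ k) := by
        refine Finset.sum_le_sum fun e _ => Finset.sum_le_sum fun k _ => ?_
        rcases Finset.eq_empty_or_nonempty ((S.filter fun f =>
          f.root.card + 1 - f.heavy.card = e).filter fun f => f.root.card = k) with h | ⟨g, hg⟩
        · rw [h, Finset.sum_empty]; positivity
        simp only [Finset.mem_filter] at hg
        have hgS := hS g hg.1.1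
        have hke : k + 1 - (k + 1 - e) = e := by omega
        rw [← mul_assoc]
        conv_rhs => rw [← hke]
        refine PairFlow.sum_weight_le_pow hK hn (by omega) (by omega) (by omega) hs _ ?_ ?_
        · intro f hf
          simp only [Finset.mem_filter] at hf
          have := hS f hf.1.1
          omega
        · intro f hf
          simp only [Finset.mem_filter] at hf
          exact hf.2
    _ = (n : ℝ) ^ (p + 1) * ∑ e ∈ Finset.Icc 1 p, ∑ k ∈ Finset.range (3 * e + 2),
          ((p : ℝ) ^ 2 / n) ^ e * C ^ k := by simp only [Finset.mul_sum]
    _ ≤ (n : ℝ) ^ (p + 1) * (20 * C ^ 4 * ((p : ℝ) ^ 2 / n)) :=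
        mul_le_mul_of_nonneg_left (sum_excess_le (by positivity) hC hx p) (by positivity)
    _ = _ := by rw [pow_succ]; field_simp

end Walks

/-! ### Mixed moments of the entries of the random matrix -/

section Moments

open scoped ComplexConjugate

variable {Ω : Type u} [MeasurableSpace Ω] {P : Measure Ω} {K : ℝ} {n : ℕ}
  {X : Ω → Matrix (Fin n) (Fin n) ℂ}

lemma IsSubexpMatrix.mono (h : IsSubexpMatrix P K X) (hK : 0 ≤ K) {K' : ℝ} (hKK' : K ≤ K') :
    IsSubexpMatrix P K' X where
  measurable_entry := h.measurable_entry
  indep := h.indep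
  mean_zero := h.mean_zero
  variance_one := h.variance_one
  integrable_moment := h.integrable_moment
  moment_le i j m hm := (h.moment_le i j m hm).trans (by gcongr)

lemma iIndepFun.integrable_fun_prod_comp {ι : Type*} [Fintype ι] {Y : ι → Ω → ℂ} {f : ι → ℂ → ℂ}
    (hY : iIndepFun Y P) (mY : ∀ i, Measurable (Y i)) (mf : ∀ i, Measurable (f i))
    (hf : ∀ i, Integrable (fun ω => f i (Y i ω)) P) :
    Integrable (fun ω => ∏ i, f i (Y i ω)) P := by
  have := hY.isProbabilityMeasure
  have hprob : ∀ i, IsProbabilityMeasure (P.map (Y i)) := fun i =>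
    Measure.isProbabilityMeasure_map (mY i).aemeasurable
  have h1 : Integrable (fun x : ι → ℂ => ∏ i, f i (x i)) (Measure.pi fun i => P.map (Y i)) := by
    refine Integrable.fintype_prod fun i => ?_
    exact (integrable_map_measure (mf i).aestronglyMeasurable (mY i).aemeasurable).2 (hf i)
  rw [← hY.map_fun_eq_pi_map fun i => (mY i).aemeasurable] at h1
  exact h1.comp_aemeasurable (measurable_pi_lambda _ fun i => mY i).aemeasurable

lemma norm_mixed_power (x : ℂ) (a b : ℕ) : ‖x ^ a * conj x ^ b‖ = ‖x‖ ^ (a + b) := by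
  rw [norm_mul, norm_pow, norm_pow, RCLike.norm_conj, pow_add]

lemma measurable_mixed_power (a b : ℕ) : Measurable fun x : ℂ => x ^ a * conj x ^ b :=
  (Continuous.measurable (by fun_prop))

lemma IsSubexpMatrix.integrable_mixed_power [IsProbabilityMeasure P] (h : IsSubexpMatrix P K X)
    (i j : Fin n) (a b : ℕ) : Integrable (fun ω => X ω i j ^ a * conj (X ω i j) ^ b) P := by
  refine Integrable.mono' (g := fun ω => ‖X ω i j‖ ^ (a + b)) ?_
    ((measurable_mixed_power a b).comp (h.measurable_entry i j)).aestronglyMeasurable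
    (ae_of_all _ fun ω => (norm_mixed_power _ a b).le)
  rcases Nat.eq_zero_or_pos (a + b) with h0 | h0
  · simp [h0]
  · exact h.integrable_moment i j _ h0

lemma IsSubexpMatrix.norm_integral_mixed_power_le [IsProbabilityMeasure P]
    (h : IsSubexpMatrix P K X) (i j : Fin n) (a b : ℕ) :
    ‖∫ ω, X ω i j ^ a * conj (X ω i j) ^ b ∂P‖ ≤ momentBound K (a + b) := by
  have hle : ‖∫ ω, X ω i j ^ a * conj (X ω i j) ^ b ∂P‖ ≤ ∫ ω, ‖X ω i j‖ ^ (a + b) ∂P := by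
    refine (norm_integral_le_integral_norm _).trans (le_of_eq ?_)
    simp only [norm_mixed_power]
  unfold momentBound
  split_ifs with h0 h1 h2
  · refine hle.trans ?_
    simp [h0]
  · have hz : ∫ ω, X ω i j ^ a * conj (X ω i j) ^ b ∂P = 0 := by
      rcases Nat.eq_zero_or_pos a with rfl | ha
      · obtain rfl : b = 1 := by omega
        simp only [pow_zero, one_mul, pow_one]
        rw [integral_conj, h.mean_zero, map_zero]
      · obtain rfl : a = 1 := by omega
        obtain rfl : b = 0 := by omega
        simpa using h.mean_zero i j
    rw [hz, norm_zero]
  · refine hle.trans ?_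
    rw [h2, h.variance_one]
  · exact hle.trans (h.moment_le i j _ (by omega))

lemma IsSubexpMatrix.integral_mixed_power_self [IsProbabilityMeasure P]
    (h : IsSubexpMatrix P K X) (i j : Fin n) {a : ℕ} (ha : a ≤ 1) :
    ∫ ω, X ω i j ^ a * conj (X ω i j) ^ a ∂P = 1 := by
  rcases Nat.le_one_iff_eq_zero_or_eq_one.1 ha with rfl | rfl
  · simp
  · simp only [pow_one, Complex.mul_conj']
    have := h.variance_one i j
    rw [← Complex.ofReal_one, ← this, ← integral_complex_ofReal]
    simp

end Moments

/-! ### The moments as sums over pairs of walks -/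

section TraceMoment

open scoped ComplexConjugate

variable {n p : ℕ}

/-- The product of the entries of `Y` along the walk `u` and of the conjugate entries along `v`. -/
noncomputable def walkTerm (Y : Matrix (Fin n) (Fin n) ℂ) (u v : Fin (p + 1) → Fin n) : ℂ :=
  ∏ e : Fin n × Fin n, Y e.1 e.2 ^ edgeCount u e.1 e.2 * conj (Y e.1 e.2) ^ edgeCount v e.1 e.2

lemma trace_pow_mul_conjTranspose_pow (Y : Matrix (Fin n) (Fin n) ℂ) :
    (Y ^ p * Yᴴ ^ p).trace = ((∑ i, ∑ j, ‖(Y ^ p) i j‖ ^ 2 : ℝ) : ℂ) := by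
  rw [← Matrix.conjTranspose_pow, Matrix.trace]
  push_cast
  refine Finset.sum_congr rfl fun i _ => ?_
  rw [Matrix.diag_apply, Matrix.mul_apply]
  refine Finset.sum_congr rfl fun j _ => ?_
  rw [Matrix.conjTranspose_apply, Complex.star_def, Complex.mul_conj']

lemma trace_eq_sum_walkTerm (Y : Matrix (Fin n) (Fin n) ℂ) :
    (Y ^ p * Yᴴ ^ p).trace = ∑ x : (Fin (p + 1) → Fin n) × (Fin (p + 1) → Fin n),
      if x.1 0 = x.2 0 ∧ x.1 (Fin.last p) = x.2 (Fin.last p) then walkTerm Y x.1 x.2 else 0 := by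
  have hterm : ∀ u v : Fin (p + 1) → Fin n, walkTerm Y u v =
      (∏ t : Fin p, Y (u t.castSucc) (u t.succ)) *
        conj (∏ t : Fin p, Y (v t.castSucc) (v t.succ)) := by
    intro u v
    have hu : ∀ u : Fin (p + 1) → Fin n, ∏ t : Fin p, Y (u t.castSucc) (u t.succ) =
        ∏ i, ∏ j, Y i j ^ edgeCount u i j := prod_edges_eq (fun i j => Y i j)
    rw [hu, hu, walkTerm, Finset.prod_mul_distrib, Fintype.prod_prod_type, Fintype.prod_prod_type]
    simp only [map_prod, map_pow]
  have hcomm : ∀ F : Fin n → Fin n → (Fin (p + 1) → Fin n) → (Fin (p + 1) → Fin n) → ℂ,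
      ∑ i, ∑ j, ∑ u, ∑ v, F i j u v = ∑ u, ∑ v, ∑ i, ∑ j, F i j u v := by
    intro F
    have h1 := Finset.sum_comm (s := (Finset.univ : Finset (Fin n × Fin n)))
      (t := (Finset.univ : Finset ((Fin (p + 1) → Fin n) × (Fin (p + 1) → Fin n))))
      (f := fun a b => F a.1 a.2 b.1 b.2)
    simpa only [Fintype.sum_prod_type] using h1
  rw [← Matrix.conjTranspose_pow, Matrix.trace, Fintype.sum_prod_type]
  simp only [Matrix.diag_apply, Matrix.mul_apply, Matrix.conjTranspose_apply, Complex.star_def,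
    pow_apply_eq_sum_walks, map_sum, Finset.sum_mul_sum, hterm]
  rw [hcomm]
  refine Finset.sum_congr rfl fun u _ => Finset.sum_congr rfl fun v _ => ?_
  rw [Finset.sum_eq_single (u 0), Finset.sum_eq_single (u (Fin.last p))]
  · rw [if_pos ⟨rfl, rfl⟩]
    by_cases hv : v 0 = u 0 ∧ v (Fin.last p) = u (Fin.last p)
    · rw [if_pos hv, if_pos ⟨hv.1.symm, hv.2.symm⟩]
    · rw [if_neg hv, if_neg fun h => hv ⟨h.1.symm, h.2.symm⟩, map_zero, mul_zero]
  · intro j _ hj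
    rw [if_neg fun h => hj h.2.symm, zero_mul]
  · simp
  · intro i _ hi
    refine Finset.sum_eq_zero fun j _ => ?_
    rw [if_neg fun h => hi h.1.symm, zero_mul]
  · simp

lemma weightedMatrix_eq_smul {b : Matrix (Fin n) (Fin n) ℝ} (hb : IsHomogeneousProfile b)
    (Y : Matrix (Fin n) (Fin n) ℂ) :
    weightedMatrix b Y = ((√(n : ℝ))⁻¹ : ℂ) • Y := by
  ext i j
  have : b i j = (√(n : ℝ))⁻¹ := by
    rw [← Real.sqrt_inv, ← one_div, ← hb.2 i j, Real.sqrt_sq (hb.1 i j)]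
  simp [weightedMatrix, this]

lemma traceMoment_weightedMatrix {b : Matrix (Fin n) (Fin n) ℝ} (hb : IsHomogeneousProfile b)
    (Y : Matrix (Fin n) (Fin n) ℂ) :
    traceMoment p (weightedMatrix b Y) = ((n : ℂ) ^ p)⁻¹ * (Y ^ p * Yᴴ ^ p).trace := by
  rw [weightedMatrix_eq_smul hb, traceMoment, Matrix.conjTranspose_smul, smul_pow, smul_pow,
    Matrix.smul_mul, Matrix.mul_smul, Matrix.trace_smul, Matrix.trace_smul, smul_smul, smul_eq_mul,
    ← mul_pow, ← inv_pow]
  congr 2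
  rw [Complex.star_def, map_inv₀, Complex.conj_ofReal, ← mul_inv, ← Complex.ofReal_mul,
    Real.mul_self_sqrt (Nat.cast_nonneg n), Complex.ofReal_natCast]

lemma edgeCount_le_one_of_injective {V : Type*} [DecidableEq V] {u : Fin (p + 1) → V}
    (hu : Function.Injective u) (i j : V) : edgeCount u i j ≤ 1 := by
  refine Finset.card_le_one.2 fun s hs t ht => ?_
  simp only [Finset.mem_filter, Finset.mem_univ, true_and, Prod.mk.injEq] at hs ht
  exact Fin.castSucc_injective _ (hu (hs.1.trans ht.1.symm))

variable {Ω : Type u} [MeasurableSpace Ω] {P : Measure Ω} [IsProbabilityMeasure P] {K : ℝ}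
  {X : Ω → Matrix (Fin n) (Fin n) ℂ}

namespace IsSubexpMatrix

variable (h : IsSubexpMatrix P K X)
include h

lemma integrable_walkTerm (u v : Fin (p + 1) → Fin n) :
    Integrable (fun ω => walkTerm (X ω) u v) P := by
  have key := iIndepFun.integrable_fun_prod_comp (P := P)
    (Y := fun (e : Fin n × Fin n) ω => X ω e.1 e.2)
    (f := fun e x => x ^ edgeCount u e.1 e.2 * conj x ^ edgeCount v e.1 e.2) h.indep
    (fun e => h.measurable_entry e.1 e.2)
    (fun e => measurable_mixed_power (edgeCount u e.1 e.2) (edgeCount v e.1 e.2))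
    fun e => h.integrable_mixed_power e.1 e.2 (edgeCount u e.1 e.2) (edgeCount v e.1 e.2)
  exact key

omit [IsProbabilityMeasure P] in
lemma integral_walkTerm (u v : Fin (p + 1) → Fin n) :
    ∫ ω, walkTerm (X ω) u v ∂P = ∏ e : Fin n × Fin n,
      ∫ ω, X ω e.1 e.2 ^ edgeCount u e.1 e.2 * conj (X ω e.1 e.2) ^ edgeCount v e.1 e.2 ∂P := by
  have key := iIndepFun.integral_fun_prod_comp (μ := P)
    (X := fun (e : Fin n × Fin n) ω => X ω e.1 e.2)
    (f := fun e x => x ^ edgeCount u e.1 e.2 * conj x ^ edgeCount v e.1 e.2) h.indep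
    (fun e => (h.measurable_entry e.1 e.2).aemeasurable)
    fun e => (measurable_mixed_power
      (edgeCount u e.1 e.2) (edgeCount v e.1 e.2)).aestronglyMeasurable
  exact key

lemma norm_integral_walkTerm_le (u v : Fin (p + 1) → Fin n) :
    ‖∫ ω, walkTerm (X ω) u v ∂P‖ ≤ ∏ i, ∏ j, momentBound K (pairCount u v i j) := by
  rw [h.integral_walkTerm, norm_prod, Fintype.prod_prod_type]
  exact Finset.prod_le_prod (fun _ _ => Finset.prod_nonneg fun _ _ => norm_nonneg _) fun i _ =>
    Finset.prod_le_prod (fun _ _ => norm_nonneg _) fun j _ => h.norm_integral_mixed_power_le i j _ _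

lemma integral_walkTerm_eq_zero {u v : Fin (p + 1) → Fin n} {i j : Fin n}
    (hij : pairCount u v i j = 1) : ∫ ω, walkTerm (X ω) u v ∂P = 0 := by
  have h1 := h.norm_integral_walkTerm_le u v
  rw [Finset.prod_eq_zero (Finset.mem_univ i)] at h1
  · exact norm_le_zero_iff.1 h1
  · exact Finset.prod_eq_zero (Finset.mem_univ j) (by simp [hij, momentBound])

lemma integral_walkTerm_self {u : Fin (p + 1) → Fin n} (hu : Function.Injective u) :
    ∫ ω, walkTerm (X ω) u u ∂P = 1 := by
  rw [h.integral_walkTerm]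
  exact Finset.prod_eq_one fun e _ =>
    h.integral_mixed_power_self e.1 e.2 (edgeCount_le_one_of_injective hu _ _)

lemma integrable_trace :
    Integrable (fun ω => (X ω ^ p * (X ω)ᴴ ^ p).trace) P := by
  simp only [trace_eq_sum_walkTerm]
  refine integrable_finsetSum _ fun x _ => ?_
  split_ifs
  · exact h.integrable_walkTerm _ _
  · exact integrable_zero _ _ _

/-- The expected trace is the number of self-avoiding walks, up to the tangled pairs. -/
lemma norm_integral_trace_sub_le [Fintype (TangledPair (Fin n) p)] :
    ‖∫ ω, (X ω ^ p * (X ω)ᴴ ^ p).trace ∂P - (n.descFactorial (p + 1) : ℂ)‖ ≤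
      ∑ x : TangledPair (Fin n) p, ∏ i, ∏ j, momentBound K (pairCount x.1.1 x.1.2 i j) := by
  classical
  have h1 : ∫ ω, (X ω ^ p * (X ω)ᴴ ^ p).trace ∂P =
      ∑ x : (Fin (p + 1) → Fin n) × (Fin (p + 1) → Fin n),
        if x.1 0 = x.2 0 ∧ x.1 (Fin.last p) = x.2 (Fin.last p) then
          ∫ ω, walkTerm (X ω) x.1 x.2 ∂P else 0 := by
    simp only [trace_eq_sum_walkTerm]
    rw [integral_finsetSum]
    · refine Finset.sum_congr rfl fun x _ => ?_
      split_ifs <;> simp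
    · intro x _
      split_ifs
      · exact h.integrable_walkTerm _ _
      · exact integrable_zero _ _ _
  have h2 : (n.descFactorial (p + 1) : ℂ) =
      ∑ x : (Fin (p + 1) → Fin n) × (Fin (p + 1) → Fin n),
        if x.1 = x.2 ∧ Function.Injective x.1 then 1 else 0 := by
    have hcard := Fintype.card_embedding_eq (α := Fin (p + 1)) (β := Fin n)
    rw [Fintype.card_fin, Fintype.card_fin] at hcard
    rw [← hcard, Fintype.sum_prod_type]
    simp only [ite_and, Finset.sum_ite_eq, Finset.mem_univ, if_true]
    rw [Finset.sum_boole, ← Fintype.card_subtype]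
    exact_mod_cast Fintype.card_congr
      (Equiv.subtypeInjectiveEquivEmbedding (Fin (p + 1)) (Fin n)).symm
  rw [h1, h2, ← Finset.sum_sub_distrib]
  have h3 : ∑ x : TangledPair (Fin n) p, ∏ i, ∏ j, momentBound K (pairCount x.1.1 x.1.2 i j) =
      ∑ x : (Fin (p + 1) → Fin n) × (Fin (p + 1) → Fin n), if (x.1 0 = x.2 0 ∧
        x.1 (Fin.last p) = x.2 (Fin.last p) ∧ (∀ i j, pairCount x.1 x.2 i j ≠ 1) ∧
        ¬ (x.1 = x.2 ∧ Function.Injective x.1)) then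
        ∏ i, ∏ j, momentBound K (pairCount x.1 x.2 i j) else 0 := by
    rw [← Finset.sum_filter]
    exact (Finset.sum_subtype _ (fun x => by simp only [Finset.mem_filter, Finset.mem_univ, true_and])
      fun x : (Fin (p + 1) → Fin n) × (Fin (p + 1) → Fin n) =>
        ∏ i, ∏ j, momentBound K (pairCount x.1 x.2 i j)).symm
  rw [h3]
  refine (norm_sum_le _ _).trans (Finset.sum_le_sum fun x _ => ?_)
  obtain ⟨u, v⟩ := x
  dsimp only
  by_cases hm : u = v ∧ Function.Injective u
  · obtain ⟨rfl, hu⟩ := hm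
    simp [hu, h.integral_walkTerm_self hu]
  · rw [if_neg hm, sub_zero]
    by_cases he : u 0 = v 0 ∧ u (Fin.last p) = v (Fin.last p)
    · rw [if_pos he]
      by_cases h1 : ∀ i j, pairCount u v i j ≠ 1
      · rw [if_pos ⟨he.1, he.2, h1, hm⟩]
        exact h.norm_integral_walkTerm_le u v
      · rw [if_neg fun h' => h1 h'.2.2.1]
        push Not at h1
        obtain ⟨i, j, hij⟩ := h1
        rw [h.integral_walkTerm_eq_zero hij, norm_zero]
    · rw [if_neg he, norm_zero, if_neg fun h' => he ⟨h'.1, h'.2.1⟩]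

end IsSubexpMatrix

/-- In the induction, p² + (p + 1) ≤ (p + 1)²; if n < p + 1 the left side is not positive. -/
lemma pow_sub_le_descFactorial (n p : ℕ) :
    (n : ℝ) ^ (p + 1) - (p : ℝ) ^ 2 * (n : ℝ) ^ p ≤ n.descFactorial (p + 1) := by
  induction p with
  | zero => simp
  | succ p ih =>
    rcases le_or_gt (p + 1) n with hpn | hpn
    · have h0 : (0 : ℝ) ≤ (n : ℝ) - (p + 1) := by
        rw [sub_nonneg]; exact_mod_cast hpn
      rw [Nat.descFactorial_succ, Nat.cast_mul, Nat.cast_sub hpn]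
      push_cast
      refine le_trans ?_ (mul_le_mul_of_nonneg_left ih h0)
      have h1 : (0 : ℝ) ≤ (p + 1) * p ^ 2 * (n : ℝ) ^ p := by positivity
      have h2 : (0 : ℝ) ≤ p * (n : ℝ) ^ (p + 1) := by positivity
      rw [pow_succ (n : ℝ) (p + 1)]
      rw [pow_succ (n : ℝ) p] at *
      nlinarith
    · refine le_trans ?_ (Nat.cast_nonneg _)
      have h1 : (n : ℝ) ≤ (p + 1 : ℕ) ^ 2 := by
        have : n ≤ (p + 1) ^ 2 := by nlinarith
        exact_mod_cast this
      rw [pow_succ (n : ℝ) (p + 1), mul_comm, ← sub_mul]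
      exact mul_nonpos_of_nonpos_of_nonneg (by linarith) (by positivity)

end TraceMoment

/-! ### The expected trace for a homogeneous variance profile -/

section Homogeneous

variable {Ω : Type u} [MeasurableSpace Ω] {P : Measure Ω} [IsProbabilityMeasure P] {K : ℝ}
  {n p : ℕ} {X : Ω → Matrix (Fin n) (Fin n) ℂ} {b : Matrix (Fin n) (Fin n) ℝ}

lemma IsSubexpMatrix.integrable_traceMoment (h : IsSubexpMatrix P K X)
    (hb : IsHomogeneousProfile b) :
    Integrable (fun ω => traceMoment p (weightedMatrix b (X ω))) P := by
  simp only [traceMoment_weightedMatrix hb]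
  exact h.integrable_trace.const_mul _

lemma traceMoment_eq_ofReal (p : ℕ) (A : Matrix (Fin n) (Fin n) ℂ) :
    traceMoment p A = ((∑ i, ∑ j, ‖(A ^ p) i j‖ ^ 2 : ℝ) : ℂ) :=
  trace_pow_mul_conjTranspose_pow A

lemma IsSubexpMatrix.norm_integral_traceMoment_sub_le (h : IsSubexpMatrix P K X) (hK : 1 ≤ K)
    (hb : IsHomogeneousProfile b) (hs : 64 * K ^ 3 * p ≤ √(n : ℝ))
    (hx : 2 * (32 * K ^ 2 * Real.exp 1 ^ 7) ^ 4 * ((p : ℝ) ^ 2 / n) ≤ 1 / 2) :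
    ‖∫ ω, traceMoment p (weightedMatrix b (X ω)) ∂P - (n : ℂ)‖ ≤
      (20 * (32 * K ^ 2 * Real.exp 1 ^ 7) ^ 4 + 1) * (p : ℝ) ^ 2 := by
  rcases Nat.eq_zero_or_pos p with rfl | hp
  · simp [traceMoment]
  have hn : 0 < n := by
    by_contra hn
    obtain rfl : n = 0 := by omega
    have : (0 : ℝ) < 64 * K ^ 3 * p := by positivity
    simp only [CharP.cast_eq_zero, Real.sqrt_zero] at hs
    linarith
  have hn0 : (0 : ℝ) < n := by exact_mod_cast hn
  have hnp : (0 : ℝ) < (n : ℝ) ^ p := by positivity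
  have hnC : (n : ℂ) ^ p ≠ 0 := pow_ne_zero _ (by exact_mod_cast hn.ne')
  have : Fintype (TangledPair (Fin n) p) := Fintype.ofFinite _
  have h1 := h.norm_integral_trace_sub_le (p := p)
  have h2 := TangledPair.sum_prod_momentBound_le (V := Fin n) hK hp 
    (by rwa [Fintype.card_fin]) (by rwa [Fintype.card_fin]) (by rwa [Fintype.card_fin])
  rw [Fintype.card_fin] at h2
  have h12 := h1.trans h2
  generalize (32 * K ^ 2 * Real.exp 1 ^ 7) ^ 4 = D at h12 ⊢
  have h3 : ‖(n.descFactorial (p + 1) : ℂ) - (n : ℂ) ^ (p + 1)‖ ≤ (p : ℝ) ^ 2 * (n : ℝ) ^ p := by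
    have hle : (n.descFactorial (p + 1) : ℝ) ≤ (n : ℝ) ^ (p + 1) := by
      exact_mod_cast Nat.descFactorial_le_pow n (p + 1)
    have hge := pow_sub_le_descFactorial n p
    have hcast : (n.descFactorial (p + 1) : ℂ) - (n : ℂ) ^ (p + 1) =
        (((n.descFactorial (p + 1) : ℝ) - (n : ℝ) ^ (p + 1) : ℝ) : ℂ) := by push_cast; rfl
    rw [hcast, Complex.norm_real, Real.norm_eq_abs, abs_le]
    constructor
    · linarith
    · have : 0 ≤ (p : ℝ) ^ 2 * (n : ℝ) ^ p := by positivity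
      linarith
  have h4 : ‖∫ ω, (X ω ^ p * (X ω)ᴴ ^ p).trace ∂P - (n : ℂ) ^ (p + 1)‖ ≤
      (20 * D + 1) * (p : ℝ) ^ 2 * (n : ℝ) ^ p := by
    calc _ = ‖(∫ ω, (X ω ^ p * (X ω)ᴴ ^ p).trace ∂P - (n.descFactorial (p + 1) : ℂ)) +
          ((n.descFactorial (p + 1) : ℂ) - (n : ℂ) ^ (p + 1))‖ := by congr 1; ring
      _ ≤ _ := norm_add_le _ _
      _ ≤ _ := add_le_add h12 h3
      _ = _ := by ring
  have h5 : ∫ ω, traceMoment p (weightedMatrix b (X ω)) ∂P - (n : ℂ) =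
      ((n : ℂ) ^ p)⁻¹ * (∫ ω, (X ω ^ p * (X ω)ᴴ ^ p).trace ∂P - (n : ℂ) ^ (p + 1)) := by
    simp only [traceMoment_weightedMatrix hb]
    rw [integral_const_mul, mul_sub, pow_succ, inv_mul_cancel_left₀ hnC]
  rw [h5, norm_mul, norm_inv, norm_pow, Complex.norm_natCast, inv_mul_le_iff₀ hnp]
  linarith

variable (K) in
/-- The expected trace differs from `n` by `O(p ^ 2)` as long as `p ^ 2` is at most a small multiple
of `n`. -/
theorem exists_norm_integral_traceMoment_sub_le (hK : 0 < K) :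
    ∃ C₀ : ℝ, 0 < C₀ ∧ ∃ C : ℝ, 0 < C ∧
      ∀ (n p : ℕ) (Ω : Type u) [MeasurableSpace Ω] (P : Measure Ω) [IsProbabilityMeasure P]
        (X : Ω → Matrix (Fin n) (Fin n) ℂ) (b : Matrix (Fin n) (Fin n) ℝ),
        IsSubexpMatrix P K X → IsHomogeneousProfile b → (p : ℝ) ^ 2 ≤ C₀ * n →
        ‖∫ ω, traceMoment p (weightedMatrix b (X ω)) ∂P - (n : ℂ)‖ ≤ C * (p : ℝ) ^ 2 := by
  -- The estimates need K ≥ 1, and enlarging `K` weakens the moment hypothesis.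
  set L := max K 1
  have hL : 1 ≤ L := le_max_right _ _
  have hL0 : 0 < L := by linarith
  set D := (32 * L ^ 2 * Real.exp 1 ^ 7) ^ 4
  have hD : 0 < D := by positivity
  -- The two terms of the minimum ensure 64 L³ p ≤ √n and 2 D p²/n ≤ 1/2. In the error constant, 20
  -- D is due to the tangled pairs and 1 to the number of self-avoiding walks.
  refine ⟨min ((64 * L ^ 3) ^ 2)⁻¹ (4 * D)⁻¹, by positivity, 20 * D + 1, by positivity, ?_⟩
  intro n p Ω _ P _ X b h hb hp
  have hn0 : (0 : ℝ) ≤ n := Nat.cast_nonneg n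
  refine (h.mono hK.le (le_max_left K 1)).norm_integral_traceMoment_sub_le hL hb ?_ ?_
  · refine Real.le_sqrt_of_sq_le ?_
    have h1 : (p : ℝ) ^ 2 ≤ ((64 * L ^ 3) ^ 2)⁻¹ * n :=
      hp.trans (mul_le_mul_of_nonneg_right (min_le_left _ _) hn0)
    rw [mul_pow]
    rwa [← div_eq_inv_mul, le_div_iff₀' (by positivity)] at h1
  · have h1 : (p : ℝ) ^ 2 ≤ (4 * D)⁻¹ * n :=
      hp.trans (mul_le_mul_of_nonneg_right (min_le_right _ _) hn0)
    have h2 : (p : ℝ) ^ 2 / n ≤ (4 * D)⁻¹ := div_le_of_le_mul₀ hn0 (by positivity) h1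
    calc 2 * D * ((p : ℝ) ^ 2 / n) ≤ 2 * D * (4 * D)⁻¹ := by gcongr
      _ = 1 / 2 := by field_simp; norm_num

end Homogeneous

theorem theorem2p2 (K : ℝ) (hK : 0 < K) :
    (∀ (Ω : ℕ → Type u) [∀ n, MeasurableSpace (Ω n)]
      (P : ∀ n, Measure (Ω n)) [∀ n, IsProbabilityMeasure (P n)]
      (X : ∀ n, Ω n → Matrix (Fin n) (Fin n) ℂ) (b : ∀ n, Matrix (Fin n) (Fin n) ℝ)
      (p : ℕ → ℕ),
      (∀ n, IsSubexpMatrix (P n) K (X n)) →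
      (∀ n, IsHomogeneousProfile (b n)) →
      (fun n => (p n : ℝ)) =o[atTop] (fun n : ℕ => √(n : ℝ)) →
      (∀ n, Integrable (fun ω => traceMoment (p n) (weightedMatrix (b n) (X n ω))) (P n)) ∧
      Tendsto
        (fun n : ℕ => (∫ ω, traceMoment (p n) (weightedMatrix (b n) (X n ω)) ∂(P n)) / (n : ℂ))
        atTop (𝓝 1)) ∧
    (∃ C₀ : ℝ, 0 < C₀ ∧ ∃ C₁ : ℝ, 0 < C₁ ∧
      ∀ (n p : ℕ) (Ω : Type u) [MeasurableSpace Ω] (P : Measure Ω) [IsProbabilityMeasure P]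
        (X : Ω → Matrix (Fin n) (Fin n) ℂ) (b : Matrix (Fin n) (Fin n) ℝ),
        IsSubexpMatrix P K X →
        IsHomogeneousProfile b →
        (p : ℝ) ^ 2 ≤ C₀ * n →
        Integrable (fun ω => traceMoment p (weightedMatrix b (X ω))) P ∧
        ∫ ω, traceMoment p (weightedMatrix b (X ω)) ∂P ≤ ((C₁ * n : ℝ) : ℂ)) := by
  obtain ⟨C₀, hC₀, C, hC, hmain⟩ := exists_norm_integral_traceMoment_sub_le.{u} K hK
  refine ⟨?_, C₀, hC₀, 1 + C * C₀, by positivity, ?_⟩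
  · intro Ω _ P _ X b p hX hb hp
    refine ⟨fun n => (hX n).integrable_traceMoment (hb n), ?_⟩
    have hsq : (fun n => (p n : ℝ) ^ 2) =o[atTop] fun n : ℕ => (n : ℝ) := by
      refine (hp.pow two_pos).congr_right fun n => ?_
      exact Real.sq_sqrt (Nat.cast_nonneg n)
    have hlim : Tendsto (fun n : ℕ => C * ((p n : ℝ) ^ 2 / n)) atTop (𝓝 0) := by
      simpa using hsq.tendsto_div_nhds_zero.const_mul C
    rw [tendsto_iff_norm_sub_tendsto_zero]
    refine squeeze_zero' (Eventually.of_forall fun n => norm_nonneg _) ?_ hlim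
    filter_upwards [hsq.bound hC₀, eventually_gt_atTop 0] with n hn hn0
    have hnR : (0 : ℝ) < n := by exact_mod_cast hn0
    have hnC : (n : ℂ) ≠ 0 := by exact_mod_cast hn0.ne'
    rw [Real.norm_of_nonneg (by positivity), Real.norm_of_nonneg hnR.le] at hn
    have h := hmain n (p n) (Ω n) (P n) (X n) (b n) (hX n) (hb n) hn
    rw [div_sub_one hnC, norm_div, Complex.norm_natCast, mul_div_assoc']
    gcongr
  · intro n p Ω _ P _ X b hX hb hp
    refine ⟨hX.integrable_traceMoment hb, ?_⟩
    have h := hmain n p Ω P X b hX hb hp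
    -- The trace is a sum of squared moduli, so the inequality in `ℂ` reduces to one between reals.
    simp only [traceMoment_eq_ofReal] at h ⊢
    rw [integral_complex_ofReal] at h ⊢
    rw [Complex.real_le_real]
    rw [← Complex.ofReal_natCast, ← Complex.ofReal_sub, Complex.norm_real] at h
    have h1 := (le_abs_self _).trans h
    have h2 : C * (p : ℝ) ^ 2 ≤ C * (C₀ * n) := mul_le_mul_of_nonneg_left hp hC.le
    linarith
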